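/- All $C^*$-algebras are complex and may be non-unital. An \emph{asymptotic homomorphism} $A\to C$ between $C^*$-algebras is a family of maps $\varphi_t:A\to C$, $t\in[0,\infty)$, such that $t\mapsto\varphi_t(a)$ is continuous for every $a\in A$ and, for all $a,b\in A$ and $c\in\mathbb C$, the differences $\varphi_t(a+b)-\varphi_t(a)-\varphi_t(b)$, $\varphi_t(ca)-c\,\varphi_t(a)$, $\varphi_t(ab)-\varphi_t(a)\varphi_t(b)$ and $\varphi_t(a^*)-\varphi_t(a)^*$ tend to $0$ in norm as $t\to\infty$. For $C^*$-algebras $A$, $D$ and $x=\sum_i a_i\odot d_i$ in the algebraic tensor product $A\odot D$, the \emph{left asymptotic tensor norm} is $$\|x\|_\lambda=\sup_{\mu,\nu}\Bigl\|\Bigl[t\mapsto\sum_i\mu_t(a_i)\otimes\nu(d_i)\Bigr]\Bigr\|,$$ the norm being that of $C_b([0,\infty),L(H_1\otimes H_2))/C_0([0,\infty),L(H_1\otimes H_2))$, and the supremum being over all asymptotic homomorphisms $\mu=(\mu_t):A\to L(H_1)$ and all $*$-homomorphisms $\nu:D\to L(H_2)$ with $H_1$, $H_2$ separable Hilbert spaces.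 An extension of $A$ by $B$ is a short exact sequence $0\to B\to E\xrightarrow{p}A\to0$ of $C^*$-algebras. It is \emph{asymptotically split} if there is an asymptotic homomorphism $(s_t):A\to E$ with $p\circ s_t=\mathrm{id}_A$ for every $t$. The \emph{direct sum} of two extensions $0\to B\to E\xrightarrow{p}A\to0$ and $0\to B\to E'\xrightarrow{p'}A\to0$ is the extension $0\to M_2(B)\to C\to A\to0$, where $C$ is the $C^*$-algebra of all matrices $\begin{pmatrix}e&b_1\\b_2&e'\end{pmatrix}$ with $e\in E$, $e'\in E'$, $b_1,b_2\in B$, $p(e)=p'(e')$ (with products such as $e\,b_1$ formed by the actions of $E$ and $E'$ on the ideal $B$), and $C\to A$ maps this matrix to $p(e)=p'(e')$; if $B$ is stable, then $M_2(B)\cong B$, so that this is again an extension of $A$ by $B$. An extension $0\to B\to E\to A\to0$ is \emph{semi-invertible} if there is an extension $0\to B\to E'\to A\to0$ such that the direct sum of the two is asymptotically split. \textbf{Proposition.} Let $0\to B\to E\xrightarrow{p}A\to0$ be an extension of separable $C^*$-algebras (for instance with $B$ stable), let $D$ be a separable $C^*$-algebra, and for $x\in A\odot D$ let $\|x\|_E$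 be the norm of the image of $x$ under the canonical map $$A\odot D=(E\odot D)/(B\odot D)\longrightarrow (E\otimes_{\min}D)/(B\otimes_{\min}D).$$ If there is an $x\in A\odot D$ with $\|x\|_E>\|x\|_\lambda$, then the extension is not semi-invertible. -/

import Mathlib

open scoped TensorProduct NNReal BoundedContinuousFunction MultiplierAlgebra
open Filter Topology

universe u v

namespace AsympTensor

noncomputable section

section HilbertTensor

set_option linter.unusedSectionVars false

variable {H K : Type*} [NormedAddCommGroup H] [InnerProductSpace ℂ H] [CompleteSpace H]
  [NormedAddCommGroup K] [InnerProductSpace ℂ K] [CompleteSpace K]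

/-- The Hilbert space tensor product of `H` and `K`: the completion of the algebraic one. -/
def HilbertTensor (H K : Type*) [NormedAddCommGroup H] [InnerProductSpace ℂ H]
    [NormedAddCommGroup K] [InnerProductSpace ℂ K] : Type _ :=
  UniformSpace.Completion (H ⊗[ℂ] K)

instance : NormedAddCommGroup (HilbertTensor H K) :=
  inferInstanceAs (NormedAddCommGroup (UniformSpace.Completion (H ⊗[ℂ] K)))

instance : InnerProductSpace ℂ (HilbertTensor H K) :=
  inferInstanceAs (InnerProductSpace ℂ (UniformSpace.Completion (H ⊗[ℂ] K)))

instance : CompleteSpace (HilbertTensor H K) :=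
  inferInstanceAs (CompleteSpace (UniformSpace.Completion (H ⊗[ℂ] K)))

/-- The isometric inclusion of the algebraic tensor product. -/
def HilbertTensor.incl : H ⊗[ℂ] K →ₗᵢ[ℂ] HilbertTensor H K :=
  UniformSpace.Completion.toComplₗᵢ

theorem HilbertTensor.denseRange_incl :
    DenseRange (HilbertTensor.incl : H ⊗[ℂ] K →ₗᵢ[ℂ] HilbertTensor H K) :=
  UniformSpace.Completion.denseRange_coe

theorem inner_map_left (S S' : H →L[ℂ] H) (x y : H ⊗[ℂ] K) :
    inner ℂ (TensorProduct.map S.toLinearMap LinearMap.id x)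
      (TensorProduct.map S'.toLinearMap LinearMap.id y)
      = inner ℂ (TensorProduct.map (star S' * S).toLinearMap LinearMap.id x) y := by
  induction x with
  | zero => simp
  | add x₁ x₂ h₁ h₂ => simp [inner_add_left, h₁, h₂]
  | tmul a b =>
    induction y with
    | zero => simp
    | add y₁ y₂ h₁ h₂ =>
      simp only [map_add, inner_add_right] at *
      rw [h₁, h₂]
    | tmul c d =>
      simp [ContinuousLinearMap.star_eq_adjoint, ContinuousLinearMap.adjoint_inner_left]

theorem norm_map_left_le (S : H →L[ℂ] H) (x : H ⊗[ℂ] K) :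
    ‖TensorProduct.map S.toLinearMap (LinearMap.id : K →ₗ[ℂ] K) x‖ ≤ ‖S‖ * ‖x‖ := by
  obtain ⟨C, hC⟩ := CStarAlgebra.nonneg_iff_eq_star_mul_self.mp
    (sub_nonneg.mpr (CStarAlgebra.star_mul_le_algebraMap_norm_sq (a := S)))
  have h1 := inner_map_left C C x x
  have hlin : TensorProduct.map (star C * C).toLinearMap (LinearMap.id : K →ₗ[ℂ] K) x
      = ((‖S‖ ^ 2 : ℝ) : ℂ) • x
        - TensorProduct.map (star S * S).toLinearMap (LinearMap.id : K →ₗ[ℂ] K) x := by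
    rw [← hC]
    induction x with
    | zero => simp
    | add x₁ x₂ h₁ h₂ =>
      rw [map_add, map_add, h₁ (inner_map_left C C x₁ x₁), h₂ (inner_map_left C C x₂ x₂),
        smul_add]
      abel
    | tmul a b =>
      simp only [TensorProduct.map_tmul, ContinuousLinearMap.toLinearMap_sub, LinearMap.sub_apply,
        TensorProduct.sub_tmul, TensorProduct.smul_tmul', Algebra.algebraMap_eq_smul_one]
      rfl
  have hsm : inner ℂ (((‖S‖ ^ 2 : ℝ) : ℂ) • x) x
      = (starRingEnd ℂ) ((‖S‖ ^ 2 : ℝ) : ℂ) * inner ℂ x x := inner_smul_left x x _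
  rw [hlin, inner_sub_left, hsm, ← inner_map_left S S x x] at h1
  have hn : ∀ z : H ⊗[ℂ] K, inner ℂ z z = ((‖z‖ ^ 2 : ℝ) : ℂ) := fun z => by
    rw [Complex.ofReal_pow]; exact inner_self_eq_norm_sq_to_K (𝕜 := ℂ) z
  rw [hn, hn, hn, Complex.conj_ofReal] at h1
  norm_cast at h1
  have h2 : ‖TensorProduct.map S.toLinearMap (LinearMap.id : K →ₗ[ℂ] K) x‖ ^ 2
      ≤ (‖S‖ * ‖x‖) ^ 2 := by
    nlinarith [sq_nonneg ‖TensorProduct.map C.toLinearMap (LinearMap.id : K →ₗ[ℂ] K) x‖]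
  exact (sq_le_sq₀ (norm_nonneg _) (by positivity)).mp h2

theorem norm_map_le (S : H →L[ℂ] H) (T : K →L[ℂ] K) (x : H ⊗[ℂ] K) :
    ‖TensorProduct.map S.toLinearMap T.toLinearMap x‖ ≤ ‖S‖ * ‖T‖ * ‖x‖ := by
  have h1 : TensorProduct.map S.toLinearMap T.toLinearMap x
      = TensorProduct.map S.toLinearMap LinearMap.id
        (TensorProduct.map LinearMap.id T.toLinearMap x) := by
    rw [← LinearMap.comp_apply, ← TensorProduct.map_comp]; simp
  have h2 : ‖TensorProduct.map (LinearMap.id : H →ₗ[ℂ] H) T.toLinearMap x‖ ≤ ‖T‖ * ‖x‖ := by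
    have := norm_map_left_le T (TensorProduct.comm ℂ H K x)
    have hc : TensorProduct.map T.toLinearMap LinearMap.id (TensorProduct.comm ℂ H K x)
        = TensorProduct.comm ℂ H K (TensorProduct.map LinearMap.id T.toLinearMap x) :=
      TensorProduct.map_comm _ _ x
    rwa [hc, TensorProduct.norm_comm, TensorProduct.norm_comm] at this
  rw [h1, mul_assoc]
  exact (norm_map_left_le S _).trans (by gcongr)

/-- The operator `S ⊗ T` on the Hilbert space tensor product, that is the bounded operator with
`(S ⊗ T) (ξ ⊗ η) = S ξ ⊗ T η`. -/
def opTensor (S : H →L[ℂ] H) (T : K →L[ℂ] K) : HilbertTensor H K →L[ℂ] HilbertTensor H K :=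
  ContinuousLinearMap.extend
    (HilbertTensor.incl.toContinuousLinearMap ∘L
      (TensorProduct.map S.toLinearMap T.toLinearMap).mkContinuous (‖S‖ * ‖T‖) (norm_map_le S T))
    (HilbertTensor.incl (H := H) (K := K)).toContinuousLinearMap

theorem opTensor_incl (S : H →L[ℂ] H) (T : K →L[ℂ] K) (x : H ⊗[ℂ] K) :
    opTensor S T (HilbertTensor.incl x)
      = HilbertTensor.incl (TensorProduct.map S.toLinearMap T.toLinearMap x) :=
  ContinuousLinearMap.extend_eq (HilbertTensor.incl.toContinuousLinearMap ∘L
      (TensorProduct.map S.toLinearMap T.toLinearMap).mkContinuous (‖S‖ * ‖T‖) (norm_map_le S T))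
    (e := (HilbertTensor.incl (H := H) (K := K)).toContinuousLinearMap)
    HilbertTensor.denseRange_incl HilbertTensor.incl.isometry.isUniformInducing x

theorem hilbertTensor_ext {f g : HilbertTensor H K →L[ℂ] HilbertTensor H K}
    (h : ∀ x : H ⊗[ℂ] K, f (HilbertTensor.incl x) = g (HilbertTensor.incl x)) : f = g := by
  ext x
  exact HilbertTensor.denseRange_incl.induction_on x (isClosed_eq f.continuous g.continuous) h

theorem norm_opTensor_le (S : H →L[ℂ] H) (T : K →L[ℂ] K) : ‖opTensor S T‖ ≤ ‖S‖ * ‖T‖ := by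
  refine ContinuousLinearMap.opNorm_le_bound _ (by positivity) fun x => ?_
  refine HilbertTensor.denseRange_incl.induction_on x
    (isClosed_le (by fun_prop) (by fun_prop)) fun x => ?_
  rw [opTensor_incl, LinearIsometry.norm_map, LinearIsometry.norm_map]
  exact norm_map_le S T x

theorem opTensor_add_left (S S' : H →L[ℂ] H) (T : K →L[ℂ] K) :
    opTensor (S + S') T = opTensor S T + opTensor S' T :=
  hilbertTensor_ext fun x => by
    simp [opTensor_incl, TensorProduct.map_add_left]

theorem opTensor_sub_left (S S' : H →L[ℂ] H) (T : K →L[ℂ] K) :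
    opTensor (S - S') T = opTensor S T - opTensor S' T := by
  rw [eq_sub_iff_add_eq, ← opTensor_add_left, sub_add_cancel]

theorem opTensor_add_right (S : H →L[ℂ] H) (T T' : K →L[ℂ] K) :
    opTensor S (T + T') = opTensor S T + opTensor S T' :=
  hilbertTensor_ext fun x => by
    simp [opTensor_incl, TensorProduct.map_add_right]

theorem opTensor_smul_left (c : ℂ) (S : H →L[ℂ] H) (T : K →L[ℂ] K) :
    opTensor (c • S) T = c • opTensor S T :=
  hilbertTensor_ext fun x => by
    simp [opTensor_incl, TensorProduct.map_smul_left]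

theorem opTensor_smul_right (c : ℂ) (S : H →L[ℂ] H) (T : K →L[ℂ] K) :
    opTensor S (c • T) = c • opTensor S T :=
  hilbertTensor_ext fun x => by
    simp [opTensor_incl, TensorProduct.map_smul_right]

/-- `(S, T) ↦ S ⊗ T` as a bilinear map. -/
def opTensorₗ (H K : Type*) [NormedAddCommGroup H] [InnerProductSpace ℂ H] [CompleteSpace H]
    [NormedAddCommGroup K] [InnerProductSpace ℂ K] [CompleteSpace K] :
    (H →L[ℂ] H) →ₗ[ℂ] (K →L[ℂ] K) →ₗ[ℂ] (HilbertTensor H K →L[ℂ] HilbertTensor H K) :=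
  LinearMap.mk₂ ℂ opTensor opTensor_add_left opTensor_smul_left opTensor_add_right
    opTensor_smul_right

theorem opTensorₗ_apply (S : H →L[ℂ] H) (T : K →L[ℂ] K) : opTensorₗ H K S T = opTensor S T := rfl

theorem continuous_opTensor_left (T : K →L[ℂ] K) :
    Continuous fun S : H →L[ℂ] H => opTensor S T :=
  AddMonoidHomClass.continuous_of_bound ((opTensorₗ H K).flip T) ‖T‖ fun S => by
    rw [mul_comm]; exact norm_opTensor_le S T

end HilbertTensor

section Asymptotic

/-- An asymptotic homomorphism `(φ_t)_{t ∈ [0, ∞)}` between C⋆-algebras: a family of maps, pointwise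
continuous in `t`, that satisfies the axioms of a ⋆-homomorphism asymptotically as `t → ∞`. -/
structure AsymptoticHom (A C : Type*) [NonUnitalCStarAlgebra A] [NonUnitalCStarAlgebra C] where
  toFun : ℝ≥0 → A → C
  continuous_path : ∀ a, Continuous fun t => toFun t a
  map_add : ∀ a b, Tendsto (fun t => toFun t (a + b) - (toFun t a + toFun t b)) atTop (𝓝 0)
  map_smul : ∀ (c : ℂ) a, Tendsto (fun t => toFun t (c • a) - c • toFun t a) atTop (𝓝 0)
  map_mul : ∀ a b, Tendsto (fun t => toFun t (a * b) - toFun t a * toFun t b) atTop (𝓝 0)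
  map_star : ∀ a, Tendsto (fun t => toFun t (star a) - star (toFun t a)) atTop (𝓝 0)

namespace AsymptoticHom

section Bounded

variable {A C : Type*} [NonUnitalCStarAlgebra A] [CStarAlgebra C]

attribute [local instance] CStarAlgebra.spectralOrder CStarAlgebra.spectralOrderedRing

theorem exists_quasi (a : A) (ha : ‖a‖ ≤ 1) :
    ∃ y : A, y * star y + a * star a = y + star y := by
  have hsa : IsSelfAdjoint (a * star a) := .mul_star_self a
  have hspec : ∀ r ∈ quasispectrum ℝ (a * star a), r ≤ 1 := fun r hr => by
    have h1 : ‖r‖ ≤ ‖a * star a‖ := by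
      have := NonUnitalIsometricContinuousFunctionalCalculus.norm_quasispectrum_le
        (𝕜 := ℝ) (a * star a) hr
      exact this
    rw [CStarRing.norm_self_mul_star] at h1
    exact (le_abs_self r).trans (h1.trans (by nlinarith [norm_nonneg a]))
  have hc : ContinuousOn (fun r : ℝ => 1 - √(1 - r)) (quasispectrum ℝ (a * star a)) := by fun_prop
  refine ⟨cfcₙ (fun r : ℝ => 1 - √(1 - r)) (a * star a), ?_⟩
  have hy : IsSelfAdjoint (cfcₙ (fun r : ℝ => 1 - √(1 - r)) (a * star a)) :=
    cfcₙ_predicate _ _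
  rw [hy.star_eq]
  have h0 : (fun r : ℝ => 1 - √(1 - r)) 0 = 0 := by simp
  have h1 : cfcₙ (fun r : ℝ => 1 - √(1 - r)) (a * star a)
        * cfcₙ (fun r : ℝ => 1 - √(1 - r)) (a * star a) + a * star a
      = cfcₙ (fun r : ℝ => (1 - √(1 - r)) * (1 - √(1 - r)) + r) (a * star a) := by
    rw [cfcₙ_add (a := a * star a) (fun r : ℝ => (1 - √(1 - r)) * (1 - √(1 - r))) (fun r => r)
      (hc.mul hc) (by simp) continuousOn_id rfl, cfcₙ_mul (a := a * star a) _ _ hc h0 hc h0,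
      cfcₙ_id' ℝ (a * star a)]
  rw [h1, ← cfcₙ_add (a := a * star a) _ _ hc h0 hc h0]
  refine cfcₙ_congr fun r hr => ?_
  have := Real.mul_self_sqrt (show 0 ≤ 1 - r by linarith [hspec r hr])
  linarith

theorem le_of_sq_le {M e : ℝ} (he : 0 ≤ e) (h : M ^ 2 ≤ 1 + e + e * M) : M ≤ 1 + e := by
  by_contra hM
  push Not at hM
  nlinarith

theorem eventually_le_of_norm_le_one (φ : AsymptoticHom A C) (a : A) (ha : ‖a‖ ≤ 1) {e : ℝ}
    (he : 0 < e) : ∀ᶠ t in atTop, ‖φ.toFun t a‖ ≤ 1 + e := by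
  obtain ⟨y, hy⟩ := exists_quasi a ha
  -- `z → 0` collects the asymptotic relations
  have hz : Tendsto (fun t => φ.toFun t y * φ.toFun t (star y) + φ.toFun t a * φ.toFun t (star a)
      - (φ.toFun t y + φ.toFun t (star y))) atTop (𝓝 0) := by
    have := ((φ.map_add y (star y)).sub (φ.map_add (y * star y) (a * star a))).sub
      ((φ.map_mul y (star y)).add (φ.map_mul a (star a)))
    simp only [sub_zero, add_zero] at this
    refine this.congr fun t => ?_
    rw [hy]
    abel
  have h1 := hz.norm
  have h2 := (φ.map_star y).norm
  have h3 := (φ.map_star a).norm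
  rw [norm_zero] at h1 h2 h3
  filter_upwards [h1.eventually (gt_mem_nhds he), h2.eventually (gt_mem_nhds (half_pos he)),
    h3.eventually (gt_mem_nhds (half_pos he))] with t h1 h2 h3
  set v := φ.toFun t a
  set w := φ.toFun t y
  set d₁ := φ.toFun t (star y) - star w with hd₁
  set d₂ := φ.toFun t (star a) - star v with hd₂
  set z := w * φ.toFun t (star y) + v * φ.toFun t (star a) - (w + φ.toFun t (star y)) with hzd
  set u := w - 1 with hu
  have key : u * star u + v * star v = 1 + z - u * d₁ - v * d₂ := by
    simp only [hzd, hd₁, hd₂, hu, star_sub, star_one]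
    noncomm_ring
  have hle : ‖u * star u + v * star v‖ ≤ 1 + e + (‖u‖ * (e / 2) + ‖v‖ * (e / 2)) := by
    rw [key]
    have a1 : ‖(1 : C)‖ ≤ 1 := by
      rcases subsingleton_or_nontrivial C with hC | hC
      · rw [Subsingleton.elim (1 : C) 0]; simp
      · exact CStarRing.norm_one.le
    have a2 := norm_mul_le u d₁
    have a3 := norm_mul_le v d₂
    have a4 : ‖u‖ * ‖d₁‖ ≤ ‖u‖ * (e / 2) := by gcongr
    have a5 : ‖v‖ * ‖d₂‖ ≤ ‖v‖ * (e / 2) := by gcongr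
    have b1 := norm_sub_le (1 + z - u * d₁) (v * d₂)
    have b2 := norm_sub_le (1 + z) (u * d₁)
    have b3 := norm_add_le 1 z
    linarith
  have hu2 : ‖u‖ ^ 2 ≤ ‖u * star u + v * star v‖ := by
    rw [sq, ← CStarRing.norm_self_mul_star]
    exact CStarAlgebra.norm_le_norm_of_nonneg_of_le (mul_star_self_nonneg u)
      (le_add_of_nonneg_right (mul_star_self_nonneg v))
  have hv2 : ‖v‖ ^ 2 ≤ ‖u * star u + v * star v‖ := by
    rw [sq, ← CStarRing.norm_self_mul_star]
    exact CStarAlgebra.norm_le_norm_of_nonneg_of_le (mul_star_self_nonneg v)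
      (le_add_of_nonneg_left (mul_star_self_nonneg u))
  rcases le_total ‖u‖ ‖v‖ with h | h
  · exact le_of_sq_le he.le (by nlinarith)
  · exact h.trans (le_of_sq_le he.le (by nlinarith))

theorem eventually_norm_le (φ : AsymptoticHom A C) (a : A) {e : ℝ} (he : 0 < e) :
    ∀ᶠ t in atTop, ‖φ.toFun t a‖ ≤ ‖a‖ + e := by
  rcases eq_or_ne a 0 with rfl | ha
  · have := (φ.map_smul 0 0).norm
    simp only [zero_smul, sub_zero, norm_zero] at this
    filter_upwards [this.eventually (gt_mem_nhds he)] with t ht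
    simpa using ht.le
  · have hpos : 0 < ‖a‖ := norm_pos_iff.mpr ha
    have h1 := φ.eventually_le_of_norm_le_one (((‖a‖ : ℂ)⁻¹) • a)
      (by rw [norm_smul]; simp [hpos.ne']) (e := e / 2 / ‖a‖) (by positivity)
    have h2 := (φ.map_smul (‖a‖ : ℂ) (((‖a‖ : ℂ)⁻¹) • a)).norm
    have hc : (‖a‖ : ℂ) ≠ 0 := by exact_mod_cast hpos.ne'
    rw [smul_inv_smul₀ hc, norm_zero] at h2
    filter_upwards [h1, h2.eventually (gt_mem_nhds (half_pos he))] with t h1 h2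
    have h3 : ‖(‖a‖ : ℂ) • φ.toFun t (((‖a‖ : ℂ)⁻¹) • a)‖ ≤ ‖a‖ * (1 + e / 2 / ‖a‖) := by
      rw [norm_smul]; simp only [Complex.norm_real, norm_norm]; gcongr
    have h4 : ‖a‖ * (1 + e / 2 / ‖a‖) = ‖a‖ + e / 2 := by field_simp
    have h5 := norm_add_le (φ.toFun t a - (‖a‖ : ℂ) • φ.toFun t (((‖a‖ : ℂ)⁻¹) • a))
      ((‖a‖ : ℂ) • φ.toFun t (((‖a‖ : ℂ)⁻¹) • a))
    rw [sub_add_cancel] at h5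
    linarith

/-- The paths of an asymptotic homomorphism are automatically bounded. -/
theorem exists_bound (φ : AsymptoticHom A C) (a : A) : ∃ M, ∀ t, ‖φ.toFun t a‖ ≤ M := by
  obtain ⟨T, hT⟩ := eventually_atTop.mp (φ.eventually_norm_le a one_pos)
  obtain ⟨M, hM⟩ := (isCompact_Icc (a := (0 : ℝ≥0)) (b := T)).exists_bound_of_continuousOn
    (φ.continuous_path a).continuousOn
  refine ⟨max M (‖a‖ + 1), fun t => ?_⟩
  rcases le_total t T with h | h
  · exact (hM t ⟨zero_le, h⟩).trans (le_max_left _ _)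
  · exact (hT t h).trans (le_max_right _ _)

end Bounded

end AsymptoticHom

/-- The elements of `C_b([0, ∞), X)` that vanish at infinity, that is `C_0([0, ∞), X)`. -/
def vanishing (X : Type*) [NormedAddCommGroup X] [NormedSpace ℂ X] : Submodule ℂ (ℝ≥0 →ᵇ X) where
  carrier := {f | Tendsto f atTop (𝓝 0)}
  zero_mem' := tendsto_const_nhds
  add_mem' hf hg := by simpa using! Tendsto.add hf hg
  smul_mem' c _ hf := by simpa using! Tendsto.const_smul hf c

/-- The quotient `C_b([0, ∞), X) / C_0([0, ∞), X)`, with the quotient norm. -/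
abbrev AsympQuotient (X : Type*) [NormedAddCommGroup X] [NormedSpace ℂ X] : Type _ :=
  (ℝ≥0 →ᵇ X) ⧸ vanishing X

section Quotient

variable {X : Type*} [NormedAddCommGroup X] [NormedSpace ℂ X]

theorem mkQ_eq {f g : ℝ≥0 →ᵇ X} (h : Tendsto (fun t => f t - g t) atTop (𝓝 0)) :
    (vanishing X).mkQ f = (vanishing X).mkQ g :=
  (Submodule.Quotient.eq _).mpr h

theorem mkQ_eq_add {f g k : ℝ≥0 →ᵇ X} (h : Tendsto (fun t => f t - (g t + k t)) atTop (𝓝 0)) :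
    (vanishing X).mkQ f = (vanishing X).mkQ g + (vanishing X).mkQ k := by
  rw [← map_add]; exact mkQ_eq h

theorem mkQ_eq_smul {f g : ℝ≥0 →ᵇ X} {c : ℂ} (h : Tendsto (fun t => f t - c • g t) atTop (𝓝 0)) :
    (vanishing X).mkQ f = c • (vanishing X).mkQ g := by
  rw [← map_smul]; exact mkQ_eq h

theorem norm_mkQ_le_of_eventually_le {f : ℝ≥0 →ᵇ X} {M : ℝ} (hM : 0 ≤ M)
    (h : ∀ᶠ t in atTop, ‖f t‖ ≤ M) : ‖(vanishing X).mkQ f‖ ≤ M := by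
  obtain ⟨T, hT⟩ := eventually_atTop.mp h
  -- stopping the clock before `T` changes the path by an element of `C_0`
  let g : ℝ≥0 →ᵇ X := f.compContinuous ⟨fun t => max t T, by fun_prop⟩
  have hg : (vanishing X).mkQ f = (vanishing X).mkQ g := by
    refine mkQ_eq (tendsto_const_nhds.congr' ?_)
    filter_upwards [eventually_ge_atTop T] with t ht
    simp [g, max_eq_left ht]
  rw [hg]
  exact (Submodule.Quotient.norm_mk_le _ _).trans
    ((BoundedContinuousFunction.norm_le hM).mpr fun t => hT _ (le_max_right _ _))

end Quotient

variable {A D H K : Type*} [NonUnitalCStarAlgebra A] [NonUnitalCStarAlgebra D]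
  [NormedAddCommGroup H] [InnerProductSpace ℂ H] [CompleteSpace H]
  [NormedAddCommGroup K] [InnerProductSpace ℂ K] [CompleteSpace K]

/-- The bounded continuous function `t ↦ μ_t(a) ⊗ ν(d) = (μ_t(a) ⊗ 1) (1 ⊗ ν(d))`. -/
def tensorPath (μ : AsymptoticHom A (H →L[ℂ] H)) (ν : D →⋆ₙₐ[ℂ] (K →L[ℂ] K)) (a : A) (d : D) :
    ℝ≥0 →ᵇ (HilbertTensor H K →L[ℂ] HilbertTensor H K) :=
  BoundedContinuousFunction.ofNormedAddCommGroup (fun t => opTensor (μ.toFun t a) (ν d))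
    ((continuous_opTensor_left (ν d)).comp (μ.continuous_path a))
    ((μ.exists_bound a).choose * ‖ν d‖) fun t => (norm_opTensor_le _ _).trans
      (mul_le_mul_of_nonneg_right ((μ.exists_bound a).choose_spec t) (norm_nonneg _))

theorem tendsto_opTensor_zero {f : ℝ≥0 → (H →L[ℂ] H)} (hf : Tendsto f atTop (𝓝 0))
    (T : K →L[ℂ] K) : Tendsto (fun t => opTensor (f t) T) atTop (𝓝 0) := by
  have h := (continuous_opTensor_left (H := H) T).tendsto 0
  have h0 : opTensor (0 : H →L[ℂ] H) T = 0 := by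
    simpa using opTensor_smul_left (0 : ℂ) (0 : H →L[ℂ] H) T
  rw [h0] at h
  exact h.comp hf

/-- The linear map `μ ⊙ ν : A ⊙ D → C_b([0, ∞), L(H ⊗ K)) / C_0([0, ∞), L(H ⊗ K))` which sends
`a ⊙ d` to the class of `t ↦ μ_t(a) ⊗ ν(d)`, for an asymptotic representation `μ` of `A` on `H`
and a representation `ν` of `D` on `K`. -/
def asympTensor (μ : AsymptoticHom A (H →L[ℂ] H)) (ν : D →⋆ₙₐ[ℂ] (K →L[ℂ] K)) :
    A ⊗[ℂ] D →ₗ[ℂ] AsympQuotient (HilbertTensor H K →L[ℂ] HilbertTensor H K) :=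
  TensorProduct.lift <| LinearMap.mk₂ ℂ
    (fun a d => (vanishing _).mkQ (tensorPath μ ν a d))
    (fun a a' d => mkQ_eq_add <| (tendsto_opTensor_zero (μ.map_add a a') (ν d)).congr fun t => by
      rw [opTensor_sub_left, opTensor_add_left]; rfl)
    (fun c a d => mkQ_eq_smul <| (tendsto_opTensor_zero (μ.map_smul c a) (ν d)).congr fun t => by
      rw [opTensor_sub_left, opTensor_smul_left]; rfl)
    (fun a d d' => mkQ_eq_add <| tendsto_const_nhds.congr fun t => by
      change 0 = opTensor _ (ν (d + d')) - (opTensor _ _ + opTensor _ _)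
      rw [_root_.map_add, opTensor_add_right, sub_self])
    (fun c a d => mkQ_eq_smul <| tendsto_const_nhds.congr fun t => by
      change 0 = opTensor _ (ν (c • d)) - c • opTensor _ _
      rw [_root_.map_smul, opTensor_smul_right, sub_self])

/-- The values `‖(μ ⊙ ν)(x)‖`, where `μ` runs over the asymptotic representations of `A` and `ν` over
the representations of `D`, both on separable Hilbert spaces. -/
def leftAsympNormSet (x : A ⊗[ℂ] D) : Set ℝ :=
  {r | ∃ (H : Type) (_ : NormedAddCommGroup H) (_ : InnerProductSpace ℂ H) (_ : CompleteSpace H)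
      (_ : TopologicalSpace.SeparableSpace H)
      (K : Type) (_ : NormedAddCommGroup K) (_ : InnerProductSpace ℂ K) (_ : CompleteSpace K)
      (_ : TopologicalSpace.SeparableSpace K)
      (μ : AsymptoticHom A (H →L[ℂ] H)) (ν : D →⋆ₙₐ[ℂ] (K →L[ℂ] K)), r = ‖asympTensor μ ν x‖}

/-- The left asymptotic tensor norm `‖x‖_λ` of `x ∈ A ⊙ D`. -/
def leftAsympNorm (x : A ⊗[ℂ] D) : ℝ := sSup (leftAsympNormSet x)

theorem norm_asympTensor_tmul_le (μ : AsymptoticHom A (H →L[ℂ] H)) (ν : D →⋆ₙₐ[ℂ] (K →L[ℂ] K))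
    (a : A) (d : D) : ‖asympTensor μ ν (a ⊗ₜ d)‖ ≤ ‖a‖ * ‖d‖ := by
  have hν : ‖ν d‖ ≤ ‖d‖ := NonUnitalStarAlgHom.norm_apply_le ν d
  have key : ∀ e : ℝ, 0 < e → ‖asympTensor μ ν (a ⊗ₜ d)‖ ≤ (‖a‖ + e) * ‖d‖ := fun e he => by
    refine norm_mkQ_le_of_eventually_le (f := tensorPath μ ν a d) (by positivity) ?_
    filter_upwards [μ.eventually_norm_le a he] with t ht
    exact (norm_opTensor_le _ _).trans (by gcongr)
  refine le_of_forall_pos_le_add fun e he => ?_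
  have h1 := key (e / (‖d‖ + 1)) (by positivity)
  have h2 : e / (‖d‖ + 1) * ‖d‖ ≤ e := by
    rw [div_mul_eq_mul_div, div_le_iff₀ (by positivity)]
    nlinarith [norm_nonneg d]
  linarith

/-- The supremum that defines `‖x‖_λ` is finite. -/
theorem bddAbove_leftAsympNormSet (x : A ⊗[ℂ] D) : BddAbove (leftAsympNormSet x) := by
  suffices h : ∃ M : ℝ, ∀ r ∈ leftAsympNormSet x, r ≤ M from h
  induction x with
  | zero =>
    refine ⟨0, ?_⟩
    rintro _ ⟨_, _, _, _, _, _, _, _, _, _, μ, ν, rfl⟩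
    simp
  | tmul a d =>
    refine ⟨‖a‖ * ‖d‖, ?_⟩
    rintro _ ⟨_, _, _, _, _, _, _, _, _, _, μ, ν, rfl⟩
    exact norm_asympTensor_tmul_le μ ν a d
  | add x y hx hy =>
    obtain ⟨M, hM⟩ := hx
    obtain ⟨N, hN⟩ := hy
    refine ⟨M + N, ?_⟩
    rintro _ ⟨H, i1, i2, i3, i4, K, j1, j2, j3, j4, μ, ν, rfl⟩
    rw [_root_.map_add]
    exact (norm_add_le _ _).trans (add_le_add
      (hM _ ⟨H, i1, i2, i3, i4, K, j1, j2, j3, j4, μ, ν, rfl⟩)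
      (hN _ ⟨H, i1, i2, i3, i4, K, j1, j2, j3, j4, μ, ν, rfl⟩))

end Asymptotic

section MinTensor

variable {A D H K : Type*} [NonUnitalCStarAlgebra A] [NonUnitalCStarAlgebra D]
  [NormedAddCommGroup H] [InnerProductSpace ℂ H] [CompleteSpace H]
  [NormedAddCommGroup K] [InnerProductSpace ℂ K] [CompleteSpace K]

/-- The linear map `π ⊙ ρ : A ⊙ D → L(H ⊗ K)`, `a ⊙ d ↦ π(a) ⊗ ρ(d)`, for representations `π` of `A`
on `H` and `ρ` of `D` on `K`. -/
def repTensor (π : A →⋆ₙₐ[ℂ] (H →L[ℂ] H)) (ρ : D →⋆ₙₐ[ℂ] (K →L[ℂ] K)) :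
    A ⊗[ℂ] D →ₗ[ℂ] (HilbertTensor H K →L[ℂ] HilbertTensor H K) :=
  TensorProduct.lift <| LinearMap.mk₂ ℂ (fun a d => opTensor (π a) (ρ d))
    (fun a a' d => by rw [map_add, opTensor_add_left])
    (fun c a d => by rw [map_smul, opTensor_smul_left])
    (fun a d d' => by rw [map_add, opTensor_add_right])
    (fun c a d => by rw [map_smul, opTensor_smul_right])

/-- The values `‖(π ⊙ ρ)(x)‖`, where `π` runs over the representations of `A` and `ρ` over the
representations of `D` on separable Hilbert spaces. -/
def minNormSet (x : A ⊗[ℂ] D) : Set ℝ :=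
  {r | ∃ (H : Type) (_ : NormedAddCommGroup H) (_ : InnerProductSpace ℂ H) (_ : CompleteSpace H)
      (_ : TopologicalSpace.SeparableSpace H)
      (K : Type) (_ : NormedAddCommGroup K) (_ : InnerProductSpace ℂ K) (_ : CompleteSpace K)
      (_ : TopologicalSpace.SeparableSpace K)
      (π : A →⋆ₙₐ[ℂ] (H →L[ℂ] H)) (ρ : D →⋆ₙₐ[ℂ] (K →L[ℂ] K)), r = ‖repTensor π ρ x‖}

/-- The minimal (spatial) tensor norm on `A ⊙ D`, for separable C⋆-algebras `A` and `D` (for these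
it is no restriction that the Hilbert spaces are separable). -/
def minNorm (x : A ⊗[ℂ] D) : ℝ := sSup (minNormSet x)

theorem minNormSet_nonempty (x : A ⊗[ℂ] D) : (minNormSet x).Nonempty :=
  ⟨_, PUnit, inferInstance, inferInstance, inferInstance, inferInstance,
    PUnit, inferInstance, inferInstance, inferInstance, inferInstance, 0, 0, rfl⟩

theorem bddAbove_minNormSet (x : A ⊗[ℂ] D) : BddAbove (minNormSet x) := by
  suffices h : ∃ M : ℝ, ∀ r ∈ minNormSet x, r ≤ M from h
  induction x with
  | zero =>
    refine ⟨0, ?_⟩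
    rintro _ ⟨_, _, _, _, _, _, _, _, _, _, π, ρ, rfl⟩
    simp
  | tmul a d =>
    refine ⟨‖a‖ * ‖d‖, ?_⟩
    rintro _ ⟨_, _, _, _, _, _, _, _, _, _, π, ρ, rfl⟩
    exact (norm_opTensor_le _ _).trans (mul_le_mul (NonUnitalStarAlgHom.norm_apply_le π a)
      (NonUnitalStarAlgHom.norm_apply_le ρ d) (norm_nonneg _) (norm_nonneg _))
  | add x y hx hy =>
    obtain ⟨M, hM⟩ := hx
    obtain ⟨N, hN⟩ := hy
    refine ⟨M + N, ?_⟩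
    rintro _ ⟨H, i1, i2, i3, i4, K, j1, j2, j3, j4, π, ρ, rfl⟩
    rw [map_add]
    exact (norm_add_le _ _).trans (add_le_add
      (hM _ ⟨H, i1, i2, i3, i4, K, j1, j2, j3, j4, π, ρ, rfl⟩)
      (hN _ ⟨H, i1, i2, i3, i4, K, j1, j2, j3, j4, π, ρ, rfl⟩))

/-- The minimal tensor norm as a (semi)norm. -/
def minSeminorm (A D : Type*) [NonUnitalCStarAlgebra A] [NonUnitalCStarAlgebra D] :
    Seminorm ℂ (A ⊗[ℂ] D) :=
  Seminorm.ofSMulLE minNorm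
    (le_antisymm
      (csSup_le (minNormSet_nonempty _) (by
        rintro _ ⟨_, _, _, _, _, _, _, _, _, _, π, ρ, rfl⟩; simp))
      (Real.sSup_nonneg (by
        rintro _ ⟨_, _, _, _, _, _, _, _, _, _, π, ρ, rfl⟩; exact norm_nonneg _)))
    (fun x y => csSup_le (minNormSet_nonempty _) (by
      rintro _ ⟨H, i1, i2, i3, i4, K, j1, j2, j3, j4, π, ρ, rfl⟩
      rw [map_add]
      exact (norm_add_le _ _).trans (add_le_add
        (le_csSup (bddAbove_minNormSet x) ⟨H, i1, i2, i3, i4, K, j1, j2, j3, j4, π, ρ, rfl⟩)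
        (le_csSup (bddAbove_minNormSet y) ⟨H, i1, i2, i3, i4, K, j1, j2, j3, j4, π, ρ, rfl⟩))))
    (fun c x => csSup_le (minNormSet_nonempty _) (by
      rintro _ ⟨H, i1, i2, i3, i4, K, j1, j2, j3, j4, π, ρ, rfl⟩
      rw [map_smul, norm_smul]
      exact mul_le_mul_of_nonneg_left
        (le_csSup (bddAbove_minNormSet x) ⟨H, i1, i2, i3, i4, K, j1, j2, j3, j4, π, ρ, rfl⟩)
        (norm_nonneg _)))

/-- The algebraic tensor product `A ⊙ D` with the minimal tensor norm. -/
def AlgMinTensor (A D : Type*) [NonUnitalCStarAlgebra A] [NonUnitalCStarAlgebra D] : Type _ :=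
  A ⊗[ℂ] D

instance : SeminormedAddCommGroup (AlgMinTensor A D) :=
  (minSeminorm A D).toAddGroupSeminorm.toSeminormedAddCommGroup

instance : NormedSpace ℂ (AlgMinTensor A D) where
  __ : Module ℂ (AlgMinTensor A D) := inferInstanceAs (Module ℂ (A ⊗[ℂ] D))
  norm_smul_le c x := (map_smul_eq_mul (minSeminorm A D) c x).le

/-- The minimal tensor product `A ⊗_min D` (as a Banach space): the completion of `A ⊙ D` in the
minimal tensor norm. -/
abbrev MinTensor (A D : Type*) [NonUnitalCStarAlgebra A] [NonUnitalCStarAlgebra D] : Type _ :=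
  UniformSpace.Completion (AlgMinTensor A D)

/-- The canonical map `A ⊙ D → A ⊗_min D`. -/
def toMinTensor (A D : Type*) [NonUnitalCStarAlgebra A] [NonUnitalCStarAlgebra D] :
    A ⊗[ℂ] D →ₗ[ℂ] MinTensor A D :=
  (UniformSpace.Completion.toComplₗᵢ (𝕜 := ℂ) (E := AlgMinTensor A D)).toLinearMap

theorem norm_toMinTensor (x : A ⊗[ℂ] D) : ‖toMinTensor A D x‖ = minNorm x :=
  (UniformSpace.Completion.toComplₗᵢ (𝕜 := ℂ) (E := AlgMinTensor A D)).norm_map x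

end MinTensor

section Extension

/-- An extension `0 → B → E → A → 0` of `A` by `B`: a short exact sequence of C⋆-algebras. -/
structure Extension (B E A : Type*) [NonUnitalCStarAlgebra B] [NonUnitalCStarAlgebra E]
    [NonUnitalCStarAlgebra A] where
  incl : B →⋆ₙₐ[ℂ] E
  proj : E →⋆ₙₐ[ℂ] A
  incl_injective : Function.Injective incl
  proj_surjective : Function.Surjective proj
  exact : ∀ e, proj e = 0 ↔ ∃ b, incl b = e

namespace Extension

variable {B E E' A D : Type*} [NonUnitalCStarAlgebra B] [NonUnitalCStarAlgebra E]
  [NonUnitalCStarAlgebra E'] [NonUnitalCStarAlgebra A] [NonUnitalCStarAlgebra D]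

/-- An extension is asymptotically split if there is an asymptotic homomorphism `(s_t)` from `A` to
`E` such that `p ∘ s_t = id` for every `t`. -/
def AsymptoticallySplit (X : Extension B E A) : Prop :=
  ∃ s : AsymptoticHom A E, ∀ t a, X.proj (s.toFun t a) = a

theorem exists_incl_eq_mul (X : Extension B E A) (e : E) (b : B) :
    ∃ c, X.incl c = e * X.incl b :=
  (X.exact _).mp (by rw [map_mul, (X.exact _).mpr ⟨b, rfl⟩, mul_zero])

theorem exists_incl_eq_mul' (X : Extension B E A) (e : E) (b : B) :
    ∃ c, X.incl c = X.incl b * e :=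
  (X.exact _).mp (by rw [map_mul, (X.exact _).mpr ⟨b, rfl⟩, zero_mul])

theorem norm_incl (X : Extension B E A) (b : B) : ‖X.incl b‖ = ‖b‖ :=
  NonUnitalStarAlgHom.norm_map X.incl X.incl_injective b

/-- Left multiplication by `e ∈ E` on the ideal `B`. -/
def lmul (X : Extension B E A) (e : E) : B →L[ℂ] B :=
  LinearMap.mkContinuous
    { toFun := fun b => (X.exists_incl_eq_mul e b).choose
      map_add' := fun b c => X.incl_injective ((X.exists_incl_eq_mul e (b + c)).choose_spec.trans (by
        rw [map_add, map_add, (X.exists_incl_eq_mul e b).choose_spec,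
          (X.exists_incl_eq_mul e c).choose_spec, mul_add]))
      map_smul' := fun r b => X.incl_injective ((X.exists_incl_eq_mul e (r • b)).choose_spec.trans (by
        rw [map_smul, map_smul, (X.exists_incl_eq_mul e b).choose_spec, mul_smul_comm,
          RingHom.id_apply])) }
    ‖e‖ fun b => by
      rw [← X.norm_incl, ← X.norm_incl b]
      change ‖X.incl (X.exists_incl_eq_mul e b).choose‖ ≤ _
      rw [(X.exists_incl_eq_mul e b).choose_spec]
      exact norm_mul_le _ _

theorem incl_lmul (X : Extension B E A) (e : E) (b : B) : X.incl (X.lmul e b) = e * X.incl b :=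
  (X.exists_incl_eq_mul e b).choose_spec

/-- Right multiplication by `e ∈ E` on the ideal `B`. -/
def rmul (X : Extension B E A) (e : E) : B →L[ℂ] B :=
  LinearMap.mkContinuous
    { toFun := fun b => (X.exists_incl_eq_mul' e b).choose
      map_add' := fun b c => X.incl_injective ((X.exists_incl_eq_mul' e (b + c)).choose_spec.trans (by
        rw [map_add, map_add, (X.exists_incl_eq_mul' e b).choose_spec,
          (X.exists_incl_eq_mul' e c).choose_spec, add_mul]))
      map_smul' := fun r b => X.incl_injective ((X.exists_incl_eq_mul' e (r • b)).choose_spec.trans (by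
        rw [map_smul, map_smul, (X.exists_incl_eq_mul' e b).choose_spec, smul_mul_assoc,
          RingHom.id_apply])) }
    ‖e‖ fun b => by
      rw [mul_comm, ← X.norm_incl, ← X.norm_incl b]
      change ‖X.incl (X.exists_incl_eq_mul' e b).choose‖ ≤ _
      rw [(X.exists_incl_eq_mul' e b).choose_spec]
      exact norm_mul_le _ _

theorem incl_rmul (X : Extension B E A) (e : E) (b : B) : X.incl (X.rmul e b) = X.incl b * e :=
  (X.exists_incl_eq_mul' e b).choose_spec

/-- The canonical inclusion `B → M(B)`. -/
def _root_.AsympTensor.idealHom (B : Type*) [NonUnitalCStarAlgebra B] : B →⋆ₙₐ[ℂ] 𝓜(ℂ, B) :=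
  DoubleCentralizer.coeHom

theorem _root_.AsympTensor.idealHom_injective (B : Type*) [NonUnitalCStarAlgebra B] :
    Function.Injective (idealHom B) := by
  refine (injective_iff_map_eq_zero _).mpr fun b hb => ?_
  have h : b * star b = 0 := congrArg (fun z => z.fst (star b)) hb
  exact CStarRing.mul_star_self_eq_zero_iff _ |>.mp h

/-- The canonical ⋆-homomorphism `E → M(B)` into the multiplier algebra of the ideal `B`. It lifts
the Busby invariant `A → M(B) / B`. -/
def toMultiplier (X : Extension B E A) : E →⋆ₙₐ[ℂ] 𝓜(ℂ, B) where
  toFun e :=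
    { fst := X.lmul e
      snd := X.rmul e
      central := fun x y => X.incl_injective (by
        simp only [map_mul, incl_lmul, incl_rmul, mul_assoc]) }
  map_smul' r e := by
    ext b <;> apply X.incl_injective
    · simp [incl_lmul, smul_mul_assoc]
    · simp [incl_rmul, mul_smul_comm]
  map_zero' := by
    ext b <;> apply X.incl_injective
    · simp [incl_lmul]
    · simp [incl_rmul]
  map_add' e f := by
    ext b <;> apply X.incl_injective
    · simp [incl_lmul, add_mul]
    · simp [incl_rmul, mul_add]
  map_mul' e f := by
    ext b <;> apply X.incl_injective
    · simp [incl_lmul, mul_assoc]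
    · simp [incl_rmul, mul_assoc]
  map_star' e := by
    ext b <;> apply X.incl_injective
    · simp [incl_lmul, incl_rmul, map_star]
    · simp [incl_lmul, incl_rmul, map_star]

theorem toMultiplier_mul_idealHom (X : Extension B E A) (e : E) (b : B) :
    X.toMultiplier e * idealHom B b = idealHom B (X.lmul e b) := by
  ext c <;> apply X.incl_injective
  · refine (X.incl_lmul e (b * c)).trans ?_
    refine Eq.trans ?_ (map_mul X.incl (X.lmul e b) c).symm
    rw [incl_lmul, map_mul, mul_assoc]
  · refine (map_mul X.incl (X.rmul e c) b).trans ?_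
    refine Eq.trans ?_ (map_mul X.incl c (X.lmul e b)).symm
    rw [incl_lmul, incl_rmul, mul_assoc]

theorem idealHom_mul_toMultiplier (X : Extension B E A) (e : E) (b : B) :
    idealHom B b * X.toMultiplier e = idealHom B (X.rmul e b) := by
  ext c <;> apply X.incl_injective
  · refine (map_mul X.incl b (X.lmul e c)).trans ?_
    refine Eq.trans ?_ (map_mul X.incl (X.rmul e b) c).symm
    rw [incl_lmul, incl_rmul, mul_assoc]
  · refine (X.incl_rmul e (c * b)).trans ?_
    refine Eq.trans ?_ (map_mul X.incl c (X.rmul e b)).symm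
    rw [incl_rmul, map_mul, mul_assoc]

theorem toMultiplier_incl (X : Extension B E A) (b : B) :
    X.toMultiplier (X.incl b) = idealHom B b := by
  ext c <;> apply X.incl_injective
  · exact (X.incl_lmul _ _).trans (map_mul X.incl b c).symm
  · exact (X.incl_rmul _ _).trans (map_mul X.incl c b).symm

/-- The injective ⋆-homomorphism `E → M(B) ⊕ A`. -/
def toMultiplierProd (X : Extension B E A) : E →⋆ₙₐ[ℂ] 𝓜(ℂ, B) × A :=
  X.toMultiplier.prod X.proj

theorem toMultiplierProd_injective (X : Extension B E A) :
    Function.Injective X.toMultiplierProd := by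
  refine (injective_iff_map_eq_zero _).mpr fun e he => ?_
  have h1 : X.toMultiplier e = 0 := congrArg Prod.fst he
  have h2 : X.proj e = 0 := congrArg Prod.snd he
  obtain ⟨b, rfl⟩ := (X.exact e).mp h2
  have h3 : X.incl (star b) * X.incl b = 0 := by
    rw [← X.incl_rmul]
    have h4 : X.rmul (X.incl b) = 0 := congrArg (fun z => z.snd) h1
    rw [h4]; simp
  rw [map_star] at h3
  exact CStarRing.star_mul_self_eq_zero_iff _ |>.mp h3

section DirectSum

attribute [local instance] CStarAlgebra.spectralOrder CStarAlgebra.spectralOrderedRing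

/-- The C⋆-algebra `C` of the direct sum of two extensions of `A` by `B`: the algebra of all matrices
`(e, b₁; b₂, e')` with `e ∈ E`, `e' ∈ E'`, `b₁, b₂ ∈ B` and `p(e) = p'(e')`. It is realized inside
`M₂(M(B)) ⊕ A`, where an element of `E` is given by its image in `M(B)` and its image in `A`. -/
def sumAlgebra (X : Extension B E A) (X' : Extension B E' A) :
    NonUnitalStarSubalgebra ℂ (CStarMatrix (Fin 2) (Fin 2) 𝓜(ℂ, B) × A) where
  carrier := {m | (∃ e, X.toMultiplier e = m.1 0 0 ∧ X.proj e = m.2) ∧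
    (∃ e', X'.toMultiplier e' = m.1 1 1 ∧ X'.proj e' = m.2) ∧
    (∃ b₁, idealHom B b₁ = m.1 0 1) ∧
    (∃ b₂, idealHom B b₂ = m.1 1 0)}
  add_mem' := by
    rintro m n ⟨⟨e, h1, h2⟩, ⟨e', h3, h4⟩, ⟨b, h5⟩, ⟨b', h6⟩⟩
      ⟨⟨f, k1, k2⟩, ⟨f', k3, k4⟩, ⟨c, k5⟩, ⟨c', k6⟩⟩
    refine ⟨⟨e + f, ?_, ?_⟩, ⟨e' + f', ?_, ?_⟩, ⟨b + c, ?_⟩, ⟨b' + c', ?_⟩⟩ <;>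
      simp [*]
  zero_mem' := ⟨⟨0, by simp⟩, ⟨0, by simp⟩, ⟨0, by simp⟩, ⟨0, by simp⟩⟩
  smul_mem' := by
    rintro r m ⟨⟨e, h1, h2⟩, ⟨e', h3, h4⟩, ⟨b, h5⟩, ⟨b', h6⟩⟩
    refine ⟨⟨r • e, ?_, ?_⟩, ⟨r • e', ?_, ?_⟩, ⟨r • b, ?_⟩, ⟨r • b', ?_⟩⟩ <;>
      simp [*]
  mul_mem' := by
    rintro m n ⟨⟨e, h1, h2⟩, ⟨e', h3, h4⟩, ⟨b, h5⟩, ⟨b', h6⟩⟩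
      ⟨⟨f, k1, k2⟩, ⟨f', k3, k4⟩, ⟨c, k5⟩, ⟨c', k6⟩⟩
    refine ⟨⟨e * f + X.incl (b * c'), ?_, ?_⟩, ⟨X'.incl (b' * c) + e' * f', ?_, ?_⟩,
      ⟨X.lmul e c + X'.rmul f' b, ?_⟩, ⟨X.rmul f b' + X'.lmul e' c', ?_⟩⟩
    · simp [CStarMatrix.mul_apply, toMultiplier_incl, ← h1, ← k1, ← h5, ← k6]
    · simp [h2, k2, (X.exact _).mpr ⟨_, rfl⟩]
    · simp [CStarMatrix.mul_apply, toMultiplier_incl, ← h3, ← k3, ← h6, ← k5]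
    · simp [h4, k4, (X'.exact _).mpr ⟨_, rfl⟩]
    · simp [CStarMatrix.mul_apply, ← h1, ← k3, ← h5, ← k5, toMultiplier_mul_idealHom,
        idealHom_mul_toMultiplier]
    · simp [CStarMatrix.mul_apply, ← h3, ← k1, ← h6, ← k6, toMultiplier_mul_idealHom,
        idealHom_mul_toMultiplier]
  star_mem' := by
    rintro m ⟨⟨e, h1, h2⟩, ⟨e', h3, h4⟩, ⟨b, h5⟩, ⟨b', h6⟩⟩
    refine ⟨⟨star e, ?_, ?_⟩, ⟨star e', ?_, ?_⟩, ⟨star b', ?_⟩, ⟨star b, ?_⟩⟩ <;>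
      simp [CStarMatrix.star_apply, map_star, *]

theorem continuous_entry (i j : Fin 2) :
    Continuous fun m : CStarMatrix (Fin 2) (Fin 2) 𝓜(ℂ, B) × A => m.1 i j :=
  (continuous_apply j).comp ((continuous_apply i).comp
    ((CStarMatrix.ofMatrixL (m := Fin 2) (n := Fin 2) (A := 𝓜(ℂ, B))).symm.continuous.comp
      continuous_fst))

instance isClosed_sumAlgebra (X : Extension B E A) (X' : Extension B E' A) :
    IsClosed (sumAlgebra X X' : Set (CStarMatrix (Fin 2) (Fin 2) 𝓜(ℂ, B) × A)) := by
  have c1 : IsClosed (Set.range X.toMultiplierProd) :=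
    (NonUnitalStarAlgHom.isometry _ X.toMultiplierProd_injective).isClosedEmbedding.isClosed_range
  have c2 : IsClosed (Set.range X'.toMultiplierProd) :=
    (NonUnitalStarAlgHom.isometry _ X'.toMultiplierProd_injective).isClosedEmbedding.isClosed_range
  have c3 : IsClosed (Set.range (idealHom B)) :=
    (NonUnitalStarAlgHom.isometry _ (idealHom_injective B)).isClosedEmbedding.isClosed_range
  have d1 := c1.preimage ((continuous_entry (B := B) (A := A) 0 0).prodMk continuous_snd)
  have d2 := c2.preimage ((continuous_entry (B := B) (A := A) 1 1).prodMk continuous_snd)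
  have d3 := c3.preimage (continuous_entry (B := B) (A := A) 0 1)
  have d4 := c3.preimage (continuous_entry (B := B) (A := A) 1 0)
  convert d1.inter (d2.inter (d3.inter d4)) using 1
  ext m
  simp only [Set.mem_inter_iff, Set.mem_preimage, Set.mem_range, toMultiplierProd,
    NonUnitalStarAlgHom.prod_apply, Prod.ext_iff]
  rfl

/-- The direct sum of two extensions of `A` by `B`: the extension `0 → M₂(B) → C → A → 0`, where
`C → A` maps `(e, b₁; b₂, e')` to `p(e) = p'(e')`. (If `B` is stable, then `M₂(B) ≅ B` and this is
again an extension of `A` by `B`.) -/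
def directSum (X : Extension B E A) (X' : Extension B E' A) :
    Extension (CStarMatrix (Fin 2) (Fin 2) B) (sumAlgebra X X') A where
  incl := NonUnitalStarAlgHom.codRestrict
    ((CStarMatrix.mapₙₐ (idealHom B)).prod 0) (sumAlgebra X X') (fun m =>
      ⟨⟨X.incl (m 0 0), X.toMultiplier_incl _, (X.exact _).mpr ⟨_, rfl⟩⟩,
        ⟨X'.incl (m 1 1), X'.toMultiplier_incl _, (X'.exact _).mpr ⟨_, rfl⟩⟩,
        ⟨m 0 1, rfl⟩, ⟨m 1 0, rfl⟩⟩)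
  proj := (NonUnitalStarAlgHom.snd ℂ _ A).comp (NonUnitalStarSubalgebraClass.subtype _)
  incl_injective := fun m n h => by
    have h1 : CStarMatrix.mapₙₐ (R := ℂ) (idealHom B) m = CStarMatrix.mapₙₐ (idealHom B) n :=
      congrArg (fun z => z.1.1) h
    ext i j : 2
    exact idealHom_injective B (congrFun (congrFun h1 i) j)
  proj_surjective := fun a => by
    obtain ⟨e, he⟩ := X.proj_surjective a
    obtain ⟨e', he'⟩ := X'.proj_surjective a
    exact ⟨⟨(CStarMatrix.ofMatrix !![X.toMultiplier e, 0; 0, X'.toMultiplier e'], a),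
      ⟨e, rfl, he⟩, ⟨e', rfl, he'⟩, ⟨0, map_zero _⟩, ⟨0, map_zero _⟩⟩, rfl⟩
  exact := by
    rintro ⟨⟨m, a⟩, ⟨e, h1, h2⟩, ⟨e', h3, h4⟩, ⟨b, h5⟩, ⟨b', h6⟩⟩
    constructor
    · rintro (rfl : a = 0)
      obtain ⟨c, rfl⟩ := (X.exact _).mp h2
      obtain ⟨c', rfl⟩ := (X'.exact _).mp h4
      refine ⟨CStarMatrix.ofMatrix !![c, b; b', c'], Subtype.ext (Prod.ext ?_ rfl)⟩
      refine CStarMatrix.ext fun i j => ?_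
      fin_cases i <;> fin_cases j
      · exact (X.toMultiplier_incl c).symm.trans h1
      · exact h5
      · exact h6
      · exact (X'.toMultiplier_incl c').symm.trans h3
    · rintro ⟨c, hc⟩
      exact (congrArg (fun z => z.1.2) hc).symm

/-- An extension `0 → B → E → A → 0` is semi-invertible if there is an extension
`0 → B → E' → A → 0` such that the direct sum of the two is asymptotically split. -/
def SemiInvertible {B E A : Type u} [NonUnitalCStarAlgebra B] [NonUnitalCStarAlgebra E]
    [NonUnitalCStarAlgebra A] (X : Extension B E A) : Prop :=
  ∃ (E' : Type u) (_ : NonUnitalCStarAlgebra E') (X' : Extension B E' A),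
    (X.directSum X').AsymptoticallySplit

end DirectSum

section QuotientNorm

variable (D)

/-- `p ⊙ id : E ⊙ D → A ⊙ D`. -/
def projTensor (X : Extension B E A) : E ⊗[ℂ] D →ₗ[ℂ] A ⊗[ℂ] D :=
  LinearMap.rTensor D (X.proj : E →ₗ[ℂ] A)

/-- The ideal `B ⊗_min D` of `E ⊗_min D`: the closure of the image of `B ⊙ D`. -/
def minIdeal (X : Extension B E A) : Submodule ℂ (MinTensor E D) :=
  (LinearMap.range
    (toMinTensor E D ∘ₗ LinearMap.rTensor D (X.incl : B →ₗ[ℂ] E))).topologicalClosure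

/-- The map `E ⊙ D → (E ⊗_min D) / (B ⊗_min D)`. -/
def toMinQuotient (X : Extension B E A) : E ⊗[ℂ] D →ₗ[ℂ] MinTensor E D ⧸ X.minIdeal D :=
  (X.minIdeal D).mkQ ∘ₗ toMinTensor E D

theorem projTensor_surjective (X : Extension B E A) : Function.Surjective (X.projTensor D) :=
  LinearMap.rTensor_surjective D X.proj_surjective

theorem ker_projTensor_le (X : Extension B E A) :
    LinearMap.ker (X.projTensor D) ≤ LinearMap.ker (X.toMinQuotient D) := by
  have hex : Function.Exact (X.incl : B →ₗ[ℂ] E) (X.proj : E →ₗ[ℂ] A) := fun e => X.exact e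
  intro y hy
  obtain ⟨z, rfl⟩ := ((rTensor_exact D hex X.proj_surjective) y).mp hy
  refine LinearMap.mem_ker.mpr ((Submodule.Quotient.mk_eq_zero _).mpr ?_)
  exact Submodule.le_topologicalClosure _ ⟨z, rfl⟩

/-- The canonical map `A ⊙ D → A ⊗_E D = (E ⊗_min D) / (B ⊗_min D)`: the one induced by
`E ⊙ D → (E ⊗_min D) / (B ⊗_min D)` and the identification `A ⊙ D = (E ⊙ D) / ker (p ⊙ id)`. -/
def toQuotientTensor (X : Extension B E A) : A ⊗[ℂ] D →ₗ[ℂ] MinTensor E D ⧸ X.minIdeal D :=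
  (LinearMap.ker (X.projTensor D)).liftQ (X.toMinQuotient D) (X.ker_projTensor_le D) ∘ₗ
    ((X.projTensor D).quotKerEquivOfSurjective (X.projTensor_surjective D)).symm.toLinearMap

theorem toQuotientTensor_projTensor (X : Extension B E A) (y : E ⊗[ℂ] D) :
    X.toQuotientTensor D (X.projTensor D y) = X.toMinQuotient D y := by
  have h : ((X.projTensor D).quotKerEquivOfSurjective (X.projTensor_surjective D)).symm
      (X.projTensor D y) = (LinearMap.ker (X.projTensor D)).mkQ y := by
    rw [LinearEquiv.symm_apply_eq]; rfl
  simp only [toQuotientTensor, LinearMap.comp_apply, LinearEquiv.coe_coe, h]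
  exact Submodule.liftQ_apply _ _ _

variable {D}

/-- The norm `‖x‖_E` of `x ∈ A ⊙ D`: its norm in the quotient `(E ⊗_min D) / (B ⊗_min D)`. -/
def quotientNorm (X : Extension B E A) (x : A ⊗[ℂ] D) : ℝ := ‖X.toQuotientTensor D x‖

end QuotientNorm

end Extension
end Extension

end

end AsympTensor

/-! It is enough to show `X.quotientNorm x ≤ leftAsympNorm x` whenever the direct sum with some
extension `X'` has an asymptotic splitting `s`. Write `x = ∑ aᵢ ⊗ dᵢ`. The upper left corners of
`s_t(aᵢ)` lie in `E` and lift `aᵢ`, so `y_t = ∑ upperLeft (s_t(aᵢ)) ⊗ dᵢ` lifts `x`, and its minimal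
norm is at least `‖x‖_E` for every `t`. Given `r < ‖x‖_E`, representations `π_n` of `E` and `ρ_n` of
`D` can be chosen at each integer time `n` so that `(π_n ⊙ ρ_n)(y_n)` has norm greater than `r`. Let
`π` and `ρ` be their Hilbert sums.

The corner of `s_t` need not be asymptotically multiplicative, since the product of two matrices has
an off-diagonal contribution in its corner. Hence the whole matrix has to be represented. The
restriction of `π` to the ideal `B` extends to a representation of `E'` on the same space
(`extendRep`), and together they give a representation `blockRep` of the algebra of the direct sum
on `H ⊕ H`. Composing it with `s` gives an asymptotic representation `μ` of `A`. The compression of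
`μ_n(a)` to the `n`-th summand of the first copy of `H` is `π_n (upperLeft (s_n(a)))`. Compression
does not increase norms (`norm_sum_opTensor_le_of_compression`), so `∑ μ_n(aᵢ) ⊗ ρ(dᵢ)` has norm at
least `r` at every integer `n`. Integer times tend to infinity, so the class modulo `C_0` also has
norm at least `r` (`le_norm_mkQ_of_forall_nat`), whence `‖x‖_λ ≥ r`. -/

namespace AsympTensor

noncomputable section

/-! ### Compressions of operators on Hilbert tensor products -/

section Compression

variable {H H' K K' : Type*}
  [NormedAddCommGroup H] [InnerProductSpace ℂ H] [CompleteSpace H]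
  [NormedAddCommGroup H'] [InnerProductSpace ℂ H'] [CompleteSpace H']
  [NormedAddCommGroup K'] [InnerProductSpace ℂ K'] [CompleteSpace K']
  [NormedAddCommGroup K] [InnerProductSpace ℂ K] [CompleteSpace K]

/-- If `S` and `T` are the compressions of `S'` and `T'` along isometries `V` and `W`, then `S ⊗ T`
is the compression of `S' ⊗ T'` along `V ⊗ W`. -/
theorem inner_opTensor_compression (V : H →ₗᵢ[ℂ] H') (W : K →ₗᵢ[ℂ] K')
    {S : H →L[ℂ] H} {S' : H' →L[ℂ] H'} {T : K →L[ℂ] K} {T' : K' →L[ℂ] K'}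
    (hS : ∀ x y, inner ℂ (S x) y = inner ℂ (S' (V x)) (V y))
    (hT : ∀ x y, inner ℂ (T x) y = inner ℂ (T' (W x)) (W y)) (u v : H ⊗[ℂ] K) :
    inner ℂ (opTensor S T (HilbertTensor.incl u)) (HilbertTensor.incl v)
      = inner ℂ (opTensor S' T' (HilbertTensor.incl (TensorProduct.mapIsometry V W u)))
        (HilbertTensor.incl (TensorProduct.mapIsometry V W v)) := by
  rw [opTensor_incl, opTensor_incl, LinearIsometry.inner_map_map, LinearIsometry.inner_map_map]
  induction u with
  | zero => simp
  | add u₁ u₂ h₁ h₂ => simp only [map_add, inner_add_left, h₁, h₂]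
  | tmul a b =>
    induction v with
    | zero => simp
    | add v₁ v₂ h₁ h₂ => simp only [map_add, inner_add_right, h₁, h₂]
    | tmul c d => simp [hS, hT]

/-- The left-hand sum is the compression of the right-hand one along the isometry `V ⊗ W`. The
argument uses matrix coefficients on the dense algebraic tensor product, so `V ⊗ W` is needed only
there. -/
theorem norm_sum_opTensor_le_of_compression {ι : Type*} (s : Finset ι)
    (V : H →ₗᵢ[ℂ] H') (W : K →ₗᵢ[ℂ] K')
    {S : ι → H →L[ℂ] H} {S' : ι → H' →L[ℂ] H'} {T : ι → K →L[ℂ] K} {T' : ι → K' →L[ℂ] K'}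
    (hS : ∀ i x y, inner ℂ (S i x) y = inner ℂ (S' i (V x)) (V y))
    (hT : ∀ i x y, inner ℂ (T i x) y = inner ℂ (T' i (W x)) (W y)) :
    ‖∑ i ∈ s, opTensor (S i) (T i)‖ ≤ ‖∑ i ∈ s, opTensor (S' i) (T' i)‖ := by
  set F := ∑ i ∈ s, opTensor (S i) (T i) with hF
  set F' := ∑ i ∈ s, opTensor (S' i) (T' i) with hF'
  have key : ∀ u v : H ⊗[ℂ] K, inner ℂ (F (HilbertTensor.incl u)) (HilbertTensor.incl v)
      = inner ℂ (F' (HilbertTensor.incl (TensorProduct.mapIsometry V W u)))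
        (HilbertTensor.incl (TensorProduct.mapIsometry V W v)) := fun u v => by
    simp only [hF, hF', sum_apply, sum_inner]
    exact Finset.sum_congr rfl fun i _ => inner_opTensor_compression V W (hS i) (hT i) u v
  have bound : ∀ x y, ‖inner ℂ (F x) y‖ ≤ ‖F'‖ * ‖x‖ * ‖y‖ := fun x y => by
    refine HilbertTensor.denseRange_incl.induction_on₂
      (isClosed_le (by fun_prop) (by fun_prop)) (fun u v => ?_) x y
    rw [key]
    refine (norm_inner_le_norm _ _).trans ?_
    have h := F'.le_opNorm (HilbertTensor.incl (TensorProduct.mapIsometry V W u))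
    simp only [LinearIsometry.norm_map] at h ⊢
    gcongr
  refine F.opNorm_le_bound (norm_nonneg _) fun x => ?_
  -- Testing the sesquilinear bound at `y = F x` gives `‖F x‖² ≤ ‖F'‖ ‖x‖ ‖F x‖`.
  have h := bound x (F x)
  rw [inner_self_eq_norm_sq_to_K, norm_pow, RCLike.norm_ofReal, abs_norm, sq] at h
  rcases eq_or_lt_of_le (norm_nonneg (F x)) with h0 | h0
  · rw [← h0]; positivity
  · exact le_of_mul_le_mul_right h h0

end Compression

/-! ### Hilbert sums of sequences of representations -/

section HilbertSum

variable {H : ℕ → Type*} [∀ n, NormedAddCommGroup (H n)]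

/-- Each vector is the limit of its finite partial sums, and these lie in the span of countably many
separable summands. -/
theorem separableSpace_lp [∀ n, TopologicalSpace.SeparableSpace (H n)]
    [∀ n, InnerProductSpace ℂ (H n)] :
    TopologicalSpace.SeparableSpace (lp H 2) := by
  have h1 : TopologicalSpace.IsSeparable
      (⋃ n, Set.range (lp.single (E := H) 2 n)) :=
    .iUnion fun n => TopologicalSpace.isSeparable_range (lp.isometry_single n).continuous
  have h2 := (h1.span (R := ℂ)).closure
  refine TopologicalSpace.isSeparable_univ_iff.mp (h2.mono fun f _ => ?_)
  refine mem_closure_of_tendsto (lp.hasSum_single (by simp) f) (.of_forall fun s => ?_)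
  exact Submodule.sum_mem _ fun i _ => Submodule.subset_span (Set.mem_iUnion.mpr ⟨i, _, rfl⟩)

variable [∀ n, InnerProductSpace ℂ (H n)]

/-- The bounded operator on a Hilbert sum that acts diagonally by a bounded sequence of operators. -/
def diagOp (T : ∀ n, H n →L[ℂ] H n) {C : ℝ} (hC : 0 ≤ C) (hT : ∀ n, ‖T n‖ ≤ C) :
    lp H 2 →L[ℂ] lp H 2 :=
  -- Coordinatewise domination by `C • f` yields both square summability and the operator bound.
  have hle (f : lp H 2) (n : ℕ) : ‖T n (f n)‖ ≤ ‖((C : ℂ) • f) n‖ := by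
    rw [lp.coeFn_smul, Pi.smul_apply, norm_smul, Complex.norm_real, Real.norm_of_nonneg hC]
    exact (T n).le_of_opNorm_le (hT n) _
  LinearMap.mkContinuous
    { toFun := fun f => ⟨fun n => T n (f n), (lp.memℓp ((C : ℂ) • f)).mono' (hle f)⟩
      map_add' := fun f g => lp.ext (funext fun n => map_add (T n) _ _)
      map_smul' := fun c f => lp.ext (funext fun n => map_smul (T n) _ _) }
    C fun f => by
      have h := lp.norm_mono (p := 2) (by simp)
        (x := (⟨fun n => T n (f n), (lp.memℓp ((C : ℂ) • f)).mono' (hle f)⟩ : lp H 2))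
        (y := (C : ℂ) • f) (hle f)
      rwa [norm_smul, Complex.norm_real, Real.norm_of_nonneg hC] at h

theorem diagOp_apply (T : ∀ n, H n →L[ℂ] H n) {C : ℝ} (hC : 0 ≤ C) (hT : ∀ n, ‖T n‖ ≤ C)
    (f : lp H 2) (n : ℕ) : diagOp T hC hT f n = T n (f n) := rfl

variable [∀ n, CompleteSpace (H n)] {A : Type*} [NonUnitalCStarAlgebra A]

/-- The Hilbert sum of a sequence of representations. -/
def sumRep (π : ∀ n, A →⋆ₙₐ[ℂ] (H n →L[ℂ] H n)) : A →⋆ₙₐ[ℂ] (lp H 2 →L[ℂ] lp H 2) where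
  toFun a := diagOp (fun n => π n a) (norm_nonneg a)
    fun n => NonUnitalStarAlgHom.norm_apply_le (π n) a
  map_smul' c a := by
    ext f n
    simp [diagOp_apply]
  map_zero' := by
    ext f n
    simp [diagOp_apply]
  map_add' a b := by
    ext f n
    simp [diagOp_apply]
  map_mul' a b := by
    ext f n
    simp [diagOp_apply]
  map_star' a := by
    rw [ContinuousLinearMap.star_eq_adjoint, ContinuousLinearMap.eq_adjoint_iff]
    intro f g
    simp only [lp.inner_eq_tsum, diagOp_apply, map_star, ContinuousLinearMap.star_eq_adjoint,
      ContinuousLinearMap.adjoint_inner_left]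

theorem sumRep_apply (π : ∀ n, A →⋆ₙₐ[ℂ] (H n →L[ℂ] H n)) (a : A) (f : lp H 2) (n : ℕ) :
    sumRep π a f n = π n a (f n) := rfl

/-- The inclusion of a summand into a Hilbert sum. -/
def summandIncl (n : ℕ) : H n →ₗᵢ[ℂ] lp H 2 where
  toLinearMap := lp.lsingle 2 n
  norm_map' x := lp.norm_single (by simp) n x

theorem inner_sumRep_summandIncl (π : ∀ n, A →⋆ₙₐ[ℂ] (H n →L[ℂ] H n)) (n : ℕ) (a : A)
    (x y : H n) :
    inner ℂ (π n a x) y = inner ℂ (sumRep π a (summandIncl n x)) (summandIncl n y) := by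
  refine Eq.trans ?_ (lp.inner_single_right n y (sumRep π a (summandIncl n x))).symm
  rw [sumRep_apply]
  congr 2
  exact (lp.single_apply_self 2 n x).symm

end HilbertSum

/-! ### Extending a representation of an ideal to the whole algebra -/

section IdealExtension

variable {B E A : Type*} [NonUnitalCStarAlgebra B] [NonUnitalCStarAlgebra E]
  [NonUnitalCStarAlgebra A] {H : Type*} [NormedAddCommGroup H] [InnerProductSpace ℂ H]
  [CompleteSpace H]

attribute [local instance] CStarAlgebra.spectralOrder CStarAlgebra.spectralOrderedRing

/-- The linear map `B ⊙ H → H`, `b ⊗ h ↦ π (f b) h`. -/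
def actionMap (π : B →⋆ₙₐ[ℂ] (H →L[ℂ] H)) (f : B →L[ℂ] B) : B ⊗[ℂ] H →ₗ[ℂ] H :=
  TensorProduct.lift ((ContinuousLinearMap.coeLM ℂ) ∘ₗ (π : B →ₗ[ℂ] (H →L[ℂ] H)) ∘ₗ f.toLinearMap)

theorem actionMap_tmul (π : B →⋆ₙₐ[ℂ] (H →L[ℂ] H)) (f : B →L[ℂ] B) (b : B) (h : H) :
    actionMap π f (b ⊗ₜ h) = π (f b) h := rfl

theorem Extension.lmul_mul (X : Extension B E A) (e : E) (b c : B) :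
    X.lmul e (b * c) = X.lmul e b * c :=
  X.incl_injective (by simp only [X.incl_lmul, map_mul, mul_assoc])

theorem Extension.mul_lmul (X : Extension B E A) (e : E) (b c : B) :
    b * X.lmul e c = X.rmul e b * c :=
  X.incl_injective (by simp only [X.incl_lmul, X.incl_rmul, map_mul, mul_assoc])

theorem Extension.star_rmul (X : Extension B E A) (e : E) (b : B) :
    star (X.rmul e b) = X.lmul (star e) (star b) :=
  X.incl_injective (by simp only [X.incl_lmul, X.incl_rmul, map_star, star_mul])

theorem Extension.norm_lmul_le (X : Extension B E A) (e : E) (b : B) :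
    ‖X.lmul e b‖ ≤ ‖e‖ * ‖b‖ := by
  rw [← X.norm_incl, ← X.norm_incl b, X.incl_lmul]
  exact norm_mul_le _ _

/-- This makes `∑ π(bᵢ)hᵢ ↦ ∑ π(e bᵢ)hᵢ` well defined and bounded. For an approximate unit `u` of
`B`, the right-hand vector is the limit of `π(e u)` applied to the left-hand one, and `‖π(e u)‖ ≤
‖e‖`. -/
theorem norm_actionMap_lmul_le (π : B →⋆ₙₐ[ℂ] (H →L[ℂ] H)) (X : Extension B E A) (e : E)
    (z : B ⊗[ℂ] H) :
    ‖actionMap π (X.lmul e) z‖ ≤ ‖e‖ * ‖actionMap π (.id ℂ B) z‖ := by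
  have hu := CStarAlgebra.increasingApproximateUnit B
  have hlim : Tendsto (fun u => π (X.lmul e u) (actionMap π (.id ℂ B) z))
      (CStarAlgebra.approximateUnit B) (𝓝 (actionMap π (X.lmul e) z)) := by
    induction z with
    | zero => simp
    | add z w hz hw => simpa using hz.add hw
    | tmul b h =>
      simp only [actionMap_tmul, ContinuousLinearMap.id_apply]
      have hc : Continuous fun c : B => π (X.lmul e c) h :=
        ((ContinuousLinearMap.apply ℂ H h).continuous.comp (map_continuous π)).comp
          (X.lmul e).continuous
      refine ((hc.tendsto b).comp (hu.tendsto_mul_right b)).congr fun u => ?_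
      simp [X.lmul_mul]
  refine le_of_tendsto hlim.norm (hu.eventually_norm.mono fun u hu => ?_)
  refine (π (X.lmul e u)).le_of_opNorm_le ?_ _
  refine (NonUnitalStarAlgHom.norm_apply_le π _).trans ((X.norm_lmul_le e u).trans ?_)
  exact mul_le_of_le_one_right (norm_nonneg e) hu

/-- The essential subspace of a representation. -/
def essentialSpace (π : B →⋆ₙₐ[ℂ] (H →L[ℂ] H)) : Submodule ℂ H :=
  (LinearMap.range (actionMap π (.id ℂ B))).topologicalClosure

instance (π : B →⋆ₙₐ[ℂ] (H →L[ℂ] H)) : CompleteSpace (essentialSpace π) :=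
  (Submodule.isClosed_topologicalClosure _).completeSpace_coe

theorem apply_mem_essentialSpace (π : B →⋆ₙₐ[ℂ] (H →L[ℂ] H)) (b : B) (h : H) :
    π b h ∈ essentialSpace π :=
  Submodule.le_topologicalClosure _ ⟨b ⊗ₜ h, rfl⟩

theorem actionMap_mem_essentialSpace (π : B →⋆ₙₐ[ℂ] (H →L[ℂ] H)) (f : B →L[ℂ] B)
    (z : B ⊗[ℂ] H) : actionMap π f z ∈ essentialSpace π := by
  induction z with
  | zero => simp
  | add z w hz hw => simpa using add_mem hz hw
  | tmul b h => exact apply_mem_essentialSpace π _ h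

/-- By adjunction, `⟨k, π(b)h⟩ = ⟨π(b*)k, h⟩`, and `π(b*)k` lies in the essential subspace. -/
theorem apply_eq_zero_of_mem_orthogonal (π : B →⋆ₙₐ[ℂ] (H →L[ℂ] H)) (b : B) {h : H}
    (hh : h ∈ (essentialSpace π)ᗮ) : π b h = 0 := by
  refine ext_inner_left ℂ fun k => ?_
  rw [inner_zero_right, ← ContinuousLinearMap.adjoint_inner_left,
    ← ContinuousLinearMap.star_eq_adjoint, ← map_star]
  exact (Submodule.mem_orthogonal _ _).mp hh _ (apply_mem_essentialSpace π _ k)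

/-- The vectors `π(b)h` span a dense part of the essential subspace, and the orthogonal complement
supplies the rest. All algebraic identities for `extendOp` are checked by this criterion. -/
theorem ext_of_essentialSpace (π : B →⋆ₙₐ[ℂ] (H →L[ℂ] H)) {S T : H →L[ℂ] H}
    (h₁ : ∀ b h, S (π b h) = T (π b h)) (h₂ : ∀ h ∈ (essentialSpace π)ᗮ, S h = T h) : S = T := by
  have hrange : ∀ z, S (actionMap π (.id ℂ B) z) = T (actionMap π (.id ℂ B) z) := fun z => by
    induction z with
    | zero => simp
    | add z w hz hw => simp [hz, hw]
    | tmul b h => exact h₁ b h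
  have hess : ∀ h ∈ essentialSpace π, S h = T h := fun h hh => by
    refine closure_minimal (s := (LinearMap.range (actionMap π (.id ℂ B)) : Set H))
      (t := {h | S h = T h}) ?_ (isClosed_eq S.continuous T.continuous) hh
    rintro _ ⟨z, rfl⟩
    exact hrange z
  ext h
  obtain ⟨y, hy, z, hz, rfl⟩ := (essentialSpace π).exists_add_mem_mem_orthogonal h
  rw [map_add, map_add, hess y hy, h₂ z hz]

/-- The action on the essential subspace. -/
def essentialAction (π : B →⋆ₙₐ[ℂ] (H →L[ℂ] H)) (f : B →L[ℂ] B) :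
    B ⊗[ℂ] H →ₗ[ℂ] essentialSpace π :=
  (actionMap π f).codRestrict _ (actionMap_mem_essentialSpace π f)

theorem denseRange_essentialAction (π : B →⋆ₙₐ[ℂ] (H →L[ℂ] H)) :
    DenseRange (essentialAction π (.id ℂ B)) := by
  rintro ⟨h, hh⟩
  rw [closure_subtype]
  convert (show h ∈ closure (LinearMap.range (actionMap π (.id ℂ B)) : Set H) from hh) using 2
  ext k
  constructor
  · rintro ⟨_, ⟨z, rfl⟩, rfl⟩
    exact ⟨z, rfl⟩
  · rintro ⟨z, rfl⟩
    exact ⟨_, ⟨z, rfl⟩, rfl⟩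

/-- The operator by which `e ∈ E` acts on the essential subspace of a representation of the ideal
`B`, extended by zero. -/
def extendOp (π : B →⋆ₙₐ[ℂ] (H →L[ℂ] H)) (X : Extension B E A) (e : E) : H →L[ℂ] H :=
  (essentialSpace π).subtypeL ∘L
    ((essentialAction π (X.lmul e)).extendOfNorm (essentialAction π (.id ℂ B))) ∘L
    (essentialSpace π).orthogonalProjectionOnto

theorem extendOp_mem (π : B →⋆ₙₐ[ℂ] (H →L[ℂ] H)) (X : Extension B E A) (e : E) (h : H) :
    extendOp π X e h ∈ essentialSpace π := Subtype.property _

theorem extendOp_apply (π : B →⋆ₙₐ[ℂ] (H →L[ℂ] H)) (X : Extension B E A) (e : E) (b : B) (h : H) :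
    extendOp π X e (π b h) = π (X.lmul e b) h := by
  -- Density of the range and the estimate with constant `‖e‖` are what the extension by continuity
  -- requires.
  have h1 := LinearMap.extendOfNorm_eq (f := essentialAction π (X.lmul e))
    (denseRange_essentialAction π) ⟨‖e‖, norm_actionMap_lmul_le π X e⟩ (b ⊗ₜ h)
  have h2 : (essentialSpace π).orthogonalProjectionOnto (π b h)
      = essentialAction π (.id ℂ B) (b ⊗ₜ h) :=
    Submodule.orthogonalProjectionOnto_mem_subspace_eq_self
      (⟨π b h, apply_mem_essentialSpace π b h⟩ : essentialSpace π)
  simp only [extendOp, ContinuousLinearMap.comp_apply, h2, h1]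
  rfl

theorem extendOp_eq_zero (π : B →⋆ₙₐ[ℂ] (H →L[ℂ] H)) (X : Extension B E A) (e : E) {h : H}
    (hh : h ∈ (essentialSpace π)ᗮ) : extendOp π X e h = 0 := by
  simp only [extendOp, ContinuousLinearMap.comp_apply,
    Submodule.orthogonalProjectionOnto_apply_of_mem_orthogonal hh, map_zero]

theorem mul_extendOp (π : B →⋆ₙₐ[ℂ] (H →L[ℂ] H)) (X : Extension B E A) (e : E) (b : B) :
    π b * extendOp π X e = π (X.rmul e b) := by
  refine ext_of_essentialSpace π (fun c h => ?_) fun h hh => ?_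
  · rw [mul_apply_eq_comp, extendOp_apply, ← mul_apply_eq_comp,
      ← mul_apply_eq_comp, ← map_mul, ← map_mul, X.mul_lmul]
  · rw [mul_apply_eq_comp, extendOp_eq_zero π X e hh, map_zero,
      apply_eq_zero_of_mem_orthogonal π _ hh]

theorem extendOp_mul (π : B →⋆ₙₐ[ℂ] (H →L[ℂ] H)) (X : Extension B E A) (e : E) (b : B) :
    extendOp π X e * π b = π (X.lmul e b) :=
  ContinuousLinearMap.ext fun h => extendOp_apply π X e b h

/-- No nondegeneracy of `π` is needed: both sides vanish on the complement of the essential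
subspace. -/
theorem extendOp_incl (π : B →⋆ₙₐ[ℂ] (H →L[ℂ] H)) (X : Extension B E A) (b : B) :
    extendOp π X (X.incl b) = π b := by
  refine ext_of_essentialSpace π (fun c h => ?_) fun h hh => ?_
  · rw [extendOp_apply, show X.lmul (X.incl b) c = b * c from
      X.incl_injective (by rw [X.incl_lmul, map_mul]), map_mul, mul_apply_eq_comp]
  · rw [extendOp_eq_zero π X _ hh, apply_eq_zero_of_mem_orthogonal π b hh]

/-- A representation of the ideal `B` of `E` extends to a representation of `E` that vanishes on the
orthogonal complement of the essential subspace. -/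
def extendRep (π : B →⋆ₙₐ[ℂ] (H →L[ℂ] H)) (X : Extension B E A) : E →⋆ₙₐ[ℂ] (H →L[ℂ] H) where
  toFun := extendOp π X
  map_smul' c e := ext_of_essentialSpace π
    (fun b h => by
      rw [extendOp_apply, show X.lmul (c • e) b = c • X.lmul e b from
        X.incl_injective (by simp [X.incl_lmul, smul_mul_assoc])]
      simp [extendOp_apply])
    fun h hh => by simp [extendOp_eq_zero π X _ hh]
  map_zero' := ext_of_essentialSpace π
    (fun b h => by
      rw [extendOp_apply, show X.lmul 0 b = 0 from X.incl_injective (by simp [X.incl_lmul])]; simp)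
    fun h hh => by simp [extendOp_eq_zero π X _ hh]
  map_add' e f := ext_of_essentialSpace π
    (fun b h => by
      rw [extendOp_apply, show X.lmul (e + f) b = X.lmul e b + X.lmul f b from
        X.incl_injective (by simp [X.incl_lmul, add_mul])]
      simp [extendOp_apply])
    fun h hh => by simp [extendOp_eq_zero π X _ hh]
  map_mul' e f := ext_of_essentialSpace π
    (fun b h => by
      rw [extendOp_apply, show X.lmul (e * f) b = X.lmul e (X.lmul f b) from
        X.incl_injective (by simp [X.incl_lmul, mul_assoc])]
      simp [extendOp_apply])
    fun h hh => by simp [extendOp_eq_zero π X _ hh]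
  map_star' e := ext_of_essentialSpace π
    (fun b h => ext_inner_right ℂ fun k => by
      -- Moving `π b` to the other side puts `π(b*)` in front of the extended operator, where
      -- `mul_extendOp` absorbs it.
      have h1 : inner ℂ (π b h) (extendOp π X e k) = inner ℂ h (π (X.rmul e (star b)) k) := by
        rw [← mul_extendOp, map_star, ContinuousLinearMap.star_eq_adjoint,
          mul_apply_eq_comp, ContinuousLinearMap.adjoint_inner_right]
      rw [extendOp_apply, ContinuousLinearMap.star_eq_adjoint,
        ContinuousLinearMap.adjoint_inner_left, h1, ← ContinuousLinearMap.adjoint_inner_left,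
        ← ContinuousLinearMap.star_eq_adjoint, ← map_star, X.star_rmul, star_star])
    fun h hh => ext_inner_right ℂ fun k => by
      -- The adjoint also vanishes on the complement, because the extended operator takes its values
      -- in the essential subspace.
      rw [extendOp_eq_zero π X _ hh, ContinuousLinearMap.star_eq_adjoint,
        ContinuousLinearMap.adjoint_inner_left, inner_zero_left]
      exact ((Submodule.mem_orthogonal' _ _).mp hh _ (extendOp_mem π X e k)).symm

end IdealExtension

/-! ### Operators on `H ⊕ H` as `2 × 2` matrices -/

section Block

theorem separableSpace_withLp_prod {H : Type*} [NormedAddCommGroup H]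
    [TopologicalSpace.SeparableSpace H] : TopologicalSpace.SeparableSpace (WithLp 2 (H × H)) :=
  (WithLp.homeomorphProd 2 H H).symm.surjective.denseRange.separableSpace
    (WithLp.homeomorphProd 2 H H).symm.continuous

variable {H : Type*} [NormedAddCommGroup H] [InnerProductSpace ℂ H]

/-- The operator on `H ⊕ H` given by a `2 × 2` matrix of operators on `H`. -/
def blockOp (a b c d : H →L[ℂ] H) : WithLp 2 (H × H) →L[ℂ] WithLp 2 (H × H) :=
  (WithLp.prodContinuousLinearEquiv 2 ℂ H H).symm.toContinuousLinearMap ∘L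
    (((a ∘L .fst ℂ H H) + (b ∘L .snd ℂ H H)).prod ((c ∘L .fst ℂ H H) + (d ∘L .snd ℂ H H))) ∘L
    (WithLp.prodContinuousLinearEquiv 2 ℂ H H).toContinuousLinearMap

theorem blockOp_apply (a b c d : H →L[ℂ] H) (x : WithLp 2 (H × H)) :
    blockOp a b c d x = WithLp.toLp 2 (a x.fst + b x.snd, c x.fst + d x.snd) := rfl

theorem blockOp_add (a b c d a' b' c' d' : H →L[ℂ] H) :
    blockOp (a + a') (b + b') (c + c') (d + d') = blockOp a b c d + blockOp a' b' c' d' := by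
  ext x
  refine WithLp.ofLp_injective 2 (Prod.ext ?_ ?_) <;> simp [blockOp_apply, add_add_add_comm]

theorem blockOp_smul (r : ℂ) (a b c d : H →L[ℂ] H) :
    blockOp (r • a) (r • b) (r • c) (r • d) = r • blockOp a b c d := by
  ext x
  refine WithLp.ofLp_injective 2 (Prod.ext ?_ ?_) <;> simp [blockOp_apply]

theorem blockOp_mul (a b c d a' b' c' d' : H →L[ℂ] H) :
    blockOp (a * a' + b * c') (a * b' + b * d') (c * a' + d * c') (c * b' + d * d')
      = blockOp a b c d * blockOp a' b' c' d' := by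
  ext x
  refine WithLp.ofLp_injective 2 (Prod.ext ?_ ?_) <;> simp [blockOp_apply, add_add_add_comm]

theorem blockOp_star [CompleteSpace H] (a b c d : H →L[ℂ] H) :
    blockOp (star a) (star c) (star b) (star d) = star (blockOp a b c d) := by
  rw [ContinuousLinearMap.star_eq_adjoint (blockOp a b c d), ContinuousLinearMap.eq_adjoint_iff]
  intro x y
  simp only [blockOp_apply, WithLp.prod_inner_apply, inner_add_left, inner_add_right,
    ContinuousLinearMap.star_eq_adjoint, ContinuousLinearMap.adjoint_inner_left,
    WithLp.ofLp_fst, WithLp.ofLp_snd]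
  ring

/-- The inclusion of the first summand of `H ⊕ H`. -/
def fstIncl : H →ₗᵢ[ℂ] WithLp 2 (H × H) where
  toFun x := WithLp.toLp 2 (x, 0)
  map_add' x y := WithLp.ofLp_injective 2 (Prod.ext (by simp) (by simp))
  map_smul' c x := WithLp.ofLp_injective 2 (Prod.ext (by simp) (by simp))
  norm_map' x := by simp

theorem inner_blockOp_fstIncl (a b c d : H →L[ℂ] H) (x y : H) :
    inner ℂ (a x) y = inner ℂ (blockOp a b c d (fstIncl x)) (fstIncl y) := by
  simp [blockOp_apply, fstIncl, WithLp.prod_inner_apply]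

end Block

/-! ### Matrix entries in the direct sum algebra and its block representation -/

namespace Extension

variable {B E E' A : Type*} [NonUnitalCStarAlgebra B] [NonUnitalCStarAlgebra E]
  [NonUnitalCStarAlgebra E'] [NonUnitalCStarAlgebra A]
  {X : Extension B E A} {X' : Extension B E' A}

attribute [local instance] CStarAlgebra.spectralOrder CStarAlgebra.spectralOrderedRing

/-- The direct sum algebra records an element of `E` only by its images in `M(B)` and `A`. This
injectivity makes the chosen diagonal entries unique, so they obey the rules of matrix calculus. -/
theorem ext_of_toMultiplier (X : Extension B E A) {e f : E}
    (h₁ : X.toMultiplier e = X.toMultiplier f) (h₂ : X.proj e = X.proj f) : e = f :=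
  X.toMultiplierProd_injective (Prod.ext h₁ h₂)

theorem proj_incl (X : Extension B E A) (b : B) : X.proj (X.incl b) = 0 :=
  (X.exact _).mpr ⟨b, rfl⟩

/-- The entry `e` of a matrix `(e, b₁; b₂, e')` in the algebra of a direct sum. -/
def upperLeft (m : sumAlgebra X X') : E := m.2.1.choose

/-- The entry `e'` of a matrix `(e, b₁; b₂, e')` in the algebra of a direct sum. -/
def lowerRight (m : sumAlgebra X X') : E' := m.2.2.1.choose

/-- The entry `b₁` of a matrix `(e, b₁; b₂, e')` in the algebra of a direct sum. -/
def upperRight (m : sumAlgebra X X') : B := m.2.2.2.1.choose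

/-- The entry `b₂` of a matrix `(e, b₁; b₂, e')` in the algebra of a direct sum. -/
def lowerLeft (m : sumAlgebra X X') : B := m.2.2.2.2.choose

theorem toMultiplier_upperLeft (m : sumAlgebra X X') :
    X.toMultiplier (upperLeft m) = m.1.1 0 0 := m.2.1.choose_spec.1

theorem proj_upperLeft (m : sumAlgebra X X') : X.proj (upperLeft m) = m.1.2 :=
  m.2.1.choose_spec.2

theorem toMultiplier_lowerRight (m : sumAlgebra X X') :
    X'.toMultiplier (lowerRight m) = m.1.1 1 1 := m.2.2.1.choose_spec.1

theorem proj_lowerRight (m : sumAlgebra X X') : X'.proj (lowerRight m) = m.1.2 :=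
  m.2.2.1.choose_spec.2

theorem idealHom_upperRight (m : sumAlgebra X X') :
    idealHom B (upperRight m) = m.1.1 0 1 := m.2.2.2.1.choose_spec

theorem idealHom_lowerLeft (m : sumAlgebra X X') :
    idealHom B (lowerLeft m) = m.1.1 1 0 := m.2.2.2.2.choose_spec

theorem upperLeft_add (m n : sumAlgebra X X') :
    upperLeft (m + n) = upperLeft m + upperLeft n :=
  X.ext_of_toMultiplier (by simp [toMultiplier_upperLeft]) (by simp [proj_upperLeft])

theorem lowerRight_add (m n : sumAlgebra X X') :
    lowerRight (m + n) = lowerRight m + lowerRight n :=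
  X'.ext_of_toMultiplier (by simp [toMultiplier_lowerRight]) (by simp [proj_lowerRight])

theorem upperRight_add (m n : sumAlgebra X X') :
    upperRight (m + n) = upperRight m + upperRight n :=
  idealHom_injective B (by simp [idealHom_upperRight])

theorem lowerLeft_add (m n : sumAlgebra X X') :
    lowerLeft (m + n) = lowerLeft m + lowerLeft n :=
  idealHom_injective B (by simp [idealHom_lowerLeft])

theorem upperLeft_smul (c : ℂ) (m : sumAlgebra X X') :
    upperLeft (c • m) = c • upperLeft m :=
  X.ext_of_toMultiplier (by simp [toMultiplier_upperLeft]) (by simp [proj_upperLeft])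

theorem lowerRight_smul (c : ℂ) (m : sumAlgebra X X') :
    lowerRight (c • m) = c • lowerRight m :=
  X'.ext_of_toMultiplier (by simp [toMultiplier_lowerRight]) (by simp [proj_lowerRight])

theorem upperRight_smul (c : ℂ) (m : sumAlgebra X X') :
    upperRight (c • m) = c • upperRight m :=
  idealHom_injective B (by simp [idealHom_upperRight])

theorem lowerLeft_smul (c : ℂ) (m : sumAlgebra X X') :
    lowerLeft (c • m) = c • lowerLeft m :=
  idealHom_injective B (by simp [idealHom_lowerLeft])

/-- The second term is the obstruction to multiplicativity of the corner, and the reason for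
representing the full matrix. -/
theorem upperLeft_mul (m n : sumAlgebra X X') :
    upperLeft (m * n) = upperLeft m * upperLeft n + X.incl (upperRight m * lowerLeft n) :=
  X.ext_of_toMultiplier
    (by simp [toMultiplier_upperLeft, toMultiplier_incl, idealHom_upperRight, idealHom_lowerLeft,
      CStarMatrix.mul_apply])
    (by simp [proj_upperLeft, proj_incl])

theorem lowerRight_mul (m n : sumAlgebra X X') :
    lowerRight (m * n) = X'.incl (lowerLeft m * upperRight n) + lowerRight m * lowerRight n :=
  X'.ext_of_toMultiplier
    (by simp [toMultiplier_lowerRight, toMultiplier_incl, idealHom_upperRight, idealHom_lowerLeft,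
      CStarMatrix.mul_apply])
    (by simp [proj_lowerRight, proj_incl])

theorem upperRight_mul (m n : sumAlgebra X X') :
    upperRight (m * n)
      = X.lmul (upperLeft m) (upperRight n) + X'.rmul (lowerRight n) (upperRight m) :=
  idealHom_injective B (by
    simp [idealHom_upperRight, ← toMultiplier_mul_idealHom, ← idealHom_mul_toMultiplier,
      toMultiplier_upperLeft, toMultiplier_lowerRight, CStarMatrix.mul_apply])

theorem lowerLeft_mul (m n : sumAlgebra X X') :
    lowerLeft (m * n)
      = X.rmul (upperLeft n) (lowerLeft m) + X'.lmul (lowerRight m) (lowerLeft n) :=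
  idealHom_injective B (by
    simp [idealHom_lowerLeft, ← toMultiplier_mul_idealHom, ← idealHom_mul_toMultiplier,
      toMultiplier_upperLeft, toMultiplier_lowerRight, CStarMatrix.mul_apply])

theorem upperLeft_star (m : sumAlgebra X X') : upperLeft (star m) = star (upperLeft m) :=
  X.ext_of_toMultiplier (by simp [toMultiplier_upperLeft, map_star, CStarMatrix.star_apply])
    (by simp [proj_upperLeft, map_star])

theorem lowerRight_star (m : sumAlgebra X X') : lowerRight (star m) = star (lowerRight m) :=
  X'.ext_of_toMultiplier (by simp [toMultiplier_lowerRight, map_star, CStarMatrix.star_apply])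
    (by simp [proj_lowerRight, map_star])

theorem upperRight_star (m : sumAlgebra X X') : upperRight (star m) = star (lowerLeft m) :=
  idealHom_injective B (by
    simp [idealHom_upperRight, idealHom_lowerLeft, map_star, CStarMatrix.star_apply])

theorem lowerLeft_star (m : sumAlgebra X X') : lowerLeft (star m) = star (upperRight m) :=
  idealHom_injective B (by
    simp [idealHom_upperRight, idealHom_lowerLeft, map_star, CStarMatrix.star_apply])

variable {H : Type*} [NormedAddCommGroup H] [InnerProductSpace ℂ H] [CompleteSpace H]

/-- The representation of the algebra of a direct sum on `H ⊕ H` induced by a representation of `E`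
on `H`. -/
def blockRep (X : Extension B E A) (X' : Extension B E' A) (π : E →⋆ₙₐ[ℂ] (H →L[ℂ] H)) :
    sumAlgebra X X' →⋆ₙₐ[ℂ] (WithLp 2 (H × H) →L[ℂ] WithLp 2 (H × H)) where
  -- `E'` acts on `H` only through the common ideal `B`: `π` is restricted to `B` and then extended
  -- to `E'`.
  toFun m := blockOp (π (upperLeft m)) (π (X.incl (upperRight m))) (π (X.incl (lowerLeft m)))
    (extendRep (π.comp X.incl) X' (lowerRight m))
  map_smul' c m := by
    rw [upperLeft_smul, lowerRight_smul, upperRight_smul, lowerLeft_smul]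
    simp only [map_smul]
    exact blockOp_smul _ _ _ _ _
  map_zero' := by
    have h := upperLeft_smul 0 (0 : sumAlgebra X X')
    have h' := lowerRight_smul 0 (0 : sumAlgebra X X')
    have k := upperRight_smul 0 (0 : sumAlgebra X X')
    have k' := lowerLeft_smul 0 (0 : sumAlgebra X X')
    rw [zero_smul, zero_smul] at h h' k k'
    ext x
    simp [h, h', k, k', blockOp_apply]
  map_add' m n := by
    rw [upperLeft_add, lowerRight_add, upperRight_add, lowerLeft_add]
    simp only [map_add]
    exact blockOp_add _ _ _ _ _ _ _ _
  map_mul' m n := by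
    -- The three relations match the extended representation with the two actions of `E'` on `B` and
    -- with the embedding of `B` in `E'`; these are the mixed terms of a matrix product.
    have h1 (b : B) (e : E') : π (X.incl (X'.rmul e b))
        = π (X.incl b) * extendRep (π.comp X.incl) X' e :=
      (mul_extendOp (π.comp X.incl) X' e b).symm
    have h2 (b : B) (e : E') : π (X.incl (X'.lmul e b))
        = extendRep (π.comp X.incl) X' e * π (X.incl b) :=
      (extendOp_mul (π.comp X.incl) X' e b).symm
    have h3 (b : B) : extendRep (π.comp X.incl) X' (X'.incl b) = π (X.incl b) :=
      extendOp_incl (π.comp X.incl) X' b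
    rw [← blockOp_mul, upperLeft_mul, lowerRight_mul, upperRight_mul, lowerLeft_mul]
    simp only [map_add, map_mul, h1, h2, h3, incl_lmul, incl_rmul]
  map_star' m := by
    rw [upperLeft_star, lowerRight_star, upperRight_star, lowerLeft_star]
    simp only [map_star]
    exact blockOp_star _ _ _ _

theorem inner_blockRep_fstIncl (X : Extension B E A) (X' : Extension B E' A)
    (π : E →⋆ₙₐ[ℂ] (H →L[ℂ] H)) (m : sumAlgebra X X') (x y : H) :
    inner ℂ (π (upperLeft m) x) y = inner ℂ (blockRep X X' π m (fstIncl x)) (fstIncl y) :=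
  inner_blockOp_fstIncl _ _ _ _ x y

end Extension

/-! ### Lower bounds for the left asymptotic tensor norm -/

section Asymptotic

attribute [local instance] CStarAlgebra.spectralOrder CStarAlgebra.spectralOrderedRing

/-- The composition of an asymptotic homomorphism with a ⋆-homomorphism. -/
def AsymptoticHom.postcomp {A C D : Type*} [NonUnitalCStarAlgebra A] [NonUnitalCStarAlgebra C]
    [NonUnitalCStarAlgebra D] (φ : AsymptoticHom A C) (f : C →⋆ₙₐ[ℂ] D) : AsymptoticHom A D :=
  have hf {g : ℝ≥0 → C} (hg : Tendsto g atTop (𝓝 0)) : Tendsto (fun t => f (g t)) atTop (𝓝 0) :=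
    (((map_continuous f).tendsto' 0 0 (map_zero f))).comp hg
  { toFun := fun t a => f (φ.toFun t a)
    continuous_path := fun a => (map_continuous f).comp (φ.continuous_path a)
    map_add := fun a b => by simpa using hf (φ.map_add a b)
    map_smul := fun c a => by simpa using hf (φ.map_smul c a)
    map_mul := fun a b => by simpa using hf (φ.map_mul a b)
    map_star := fun a => by simpa only [_root_.map_sub, StarHomClass.map_star] using hf (φ.map_star a) }

/-- Any representative `g` of the class differs from `f` by a path vanishing at infinity, so `‖g n‖`
is almost at least `r` for large `n`. -/
theorem le_norm_mkQ_of_forall_nat {Y : Type*} [NormedAddCommGroup Y] [NormedSpace ℂ Y]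
    {f : ℝ≥0 →ᵇ Y} {r : ℝ} (h : ∀ n : ℕ, r ≤ ‖f n‖) : r ≤ ‖(vanishing Y).mkQ f‖ := by
  refine le_of_forall_pos_lt_add fun ε hε => ?_
  obtain ⟨g, hg, hlt⟩ := Submodule.Quotient.norm_mk_lt ((vanishing Y).mkQ f) (half_pos hε)
  have hfg : Tendsto (fun t => f t - g t) atTop (𝓝 0) :=
    (Submodule.Quotient.eq (vanishing Y)).mp hg.symm
  have h1 := (hfg.norm.comp (tendsto_natCast_atTop_atTop (R := ℝ≥0))).eventually
    (gt_mem_nhds (norm_zero.trans_lt (half_pos hε)))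
  obtain ⟨n, hn⟩ := h1.exists
  have h2 := norm_sub_norm_le (f n) (g n)
  have h3 := g.norm_coe_le_norm n
  have h4 := h n
  simp only [Function.comp_apply] at hn
  linarith

variable {A D : Type*} [NonUnitalCStarAlgebra A] [NonUnitalCStarAlgebra D]

theorem asympTensor_sum {H K : Type*}
    [NormedAddCommGroup H] [InnerProductSpace ℂ H] [CompleteSpace H]
    [NormedAddCommGroup K] [InnerProductSpace ℂ K] [CompleteSpace K]
    (μ : AsymptoticHom A (H →L[ℂ] H)) (ν : D →⋆ₙₐ[ℂ] (K →L[ℂ] K)) (F : Finset (A × D)) :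
    asympTensor μ ν (∑ i ∈ F, i.1 ⊗ₜ i.2)
      = (vanishing _).mkQ (∑ i ∈ F, tensorPath μ ν i.1 i.2) := by
  rw [map_sum, map_sum]
  rfl

theorem le_leftAsympNorm_of_forall_nat {H K : Type}
    [NormedAddCommGroup H] [InnerProductSpace ℂ H] [CompleteSpace H]
    [TopologicalSpace.SeparableSpace H]
    [NormedAddCommGroup K] [InnerProductSpace ℂ K] [CompleteSpace K]
    [TopologicalSpace.SeparableSpace K]
    (μ : AsymptoticHom A (H →L[ℂ] H)) (ν : D →⋆ₙₐ[ℂ] (K →L[ℂ] K)) (F : Finset (A × D)) {r : ℝ}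
    (h : ∀ n : ℕ, r ≤ ‖∑ i ∈ F, opTensor (μ.toFun n i.1) (ν i.2)‖) :
    r ≤ leftAsympNorm (∑ i ∈ F, i.1 ⊗ₜ[ℂ] i.2) := by
  have hmem : ‖asympTensor μ ν (∑ i ∈ F, i.1 ⊗ₜ i.2)‖ ≤ leftAsympNorm (∑ i ∈ F, i.1 ⊗ₜ[ℂ] i.2) :=
    le_csSup (bddAbove_leftAsympNormSet _)
      ⟨H, _, _, inferInstance, inferInstance, K, _, _, inferInstance, inferInstance, μ, ν, rfl⟩
  rw [asympTensor_sum] at hmem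
  refine (le_norm_mkQ_of_forall_nat fun n => ?_).trans hmem
  rw [BoundedContinuousFunction.sum_apply]
  exact h n

end Asymptotic

/-! ### Comparison of the quotient norm with the left asymptotic norm -/

namespace Extension

variable {B E A D : Type*} [NonUnitalCStarAlgebra B] [NonUnitalCStarAlgebra E]
  [NonUnitalCStarAlgebra A] [NonUnitalCStarAlgebra D]

attribute [local instance] CStarAlgebra.spectralOrder CStarAlgebra.spectralOrderedRing

/-- Every lift of `x` to `E ⊙ D` represents the same class in the quotient, so its minimal norm
bounds `‖x‖_E` from above. -/
theorem quotientNorm_projTensor_le (X : Extension B E A) (y : E ⊗[ℂ] D) :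
    X.quotientNorm (X.projTensor D y) ≤ minNorm y := by
  rw [quotientNorm, toQuotientTensor_projTensor, ← norm_toMinTensor]
  exact Submodule.Quotient.norm_mk_le _ _

theorem quotientNorm_le_leftAsympNorm {E' : Type*} [NonUnitalCStarAlgebra E']
    {X : Extension B E A} {X' : Extension B E' A} (h : (X.directSum X').AsymptoticallySplit)
    (x : A ⊗[ℂ] D) : X.quotientNorm x ≤ leftAsympNorm x := by
  obtain ⟨s, hs⟩ := h
  by_contra! hlt
  -- The supremum defining the minimal norm need not be attained; the gap below `‖x‖_E` allows a
  -- choice of nearly norming representations.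
  obtain ⟨r, hr1, hr2⟩ := exists_between hlt
  obtain ⟨F, rfl⟩ := TensorProduct.exists_finset x
  let y : ℝ≥0 → E ⊗[ℂ] D := fun t => ∑ i ∈ F, upperLeft (s.toFun t i.1) ⊗ₜ i.2
  have hy : ∀ t, X.projTensor D (y t) = ∑ i ∈ F, i.1 ⊗ₜ i.2 := fun t => by
    rw [map_sum]
    refine Finset.sum_congr rfl fun i _ => ?_
    exact congrArg (· ⊗ₜ[ℂ] i.2) ((proj_upperLeft _).trans (hs t i.1))
  -- The norming representations depend on the time. Restricting to integer times keeps them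
  -- countable in number, so that their Hilbert sum remains separable, as `leftAsympNorm` demands.
  have hmin : ∀ n : ℕ, ∃ z ∈ minNormSet (y n), r < z := fun n =>
    exists_lt_of_lt_csSup (minNormSet_nonempty _)
      (hr2.trans_le (hy n ▸ X.quotientNorm_projTensor_le (y n)))
  choose z hz hrz using hmin
  choose H i1 i2 i3 i4 K j1 j2 j3 j4 π ρ hπρ using hz
  have := separableSpace_lp (H := H)
  have := separableSpace_lp (H := K)
  have := separableSpace_withLp_prod (H := lp H 2)
  refine hr1.not_ge (le_leftAsympNorm_of_forall_nat
    (s.postcomp (blockRep X X' (sumRep π))) (sumRep ρ) F fun n => (hrz n).le.trans ?_)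
  have hsum : repTensor (π n) (ρ n) (y n)
      = ∑ i ∈ F, opTensor (π n (upperLeft (s.toFun n i.1))) (ρ n i.2) := map_sum _ _ _
  rw [hπρ, hsum]
  -- At time `n`, compressing to the `n`-th summands, inside the first copy of `lp H 2` on the side
  -- of `A`, recovers `π n` on the corner and `ρ n`.
  refine norm_sum_opTensor_le_of_compression F (fstIncl.comp (summandIncl n)) (summandIncl n)
    (fun i x y => ?_) (fun i x y => inner_sumRep_summandIncl ρ n i.2 x y)
  rw [inner_sumRep_summandIncl π n]
  exact inner_blockRep_fstIncl X X' (sumRep π) _ _ _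

end Extension

end

end AsympTensor

theorem mainTheorem2 {B E A : Type u} {D : Type v} [NonUnitalCStarAlgebra B]
    [NonUnitalCStarAlgebra E] [NonUnitalCStarAlgebra A] [NonUnitalCStarAlgebra D]
    [TopologicalSpace.SeparableSpace B] [TopologicalSpace.SeparableSpace E]
    [TopologicalSpace.SeparableSpace A] [TopologicalSpace.SeparableSpace D]
    (X : AsympTensor.Extension B E A) (x : A ⊗[ℂ] D)
    (hx : AsympTensor.leftAsympNorm x < X.quotientNorm x) :
    ¬ X.SemiInvertible := by
  rintro ⟨E', _, X', h⟩
  exact hx.not_ge (AsympTensor.Extension.quotientNorm_le_leftAsympNorm h x)
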